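/- Let $S=K[x_1,\ldots,x_n]$ be a polynomial ring in finitely many variables over an arbitrary field $K$, let $M\subseteq S$ be a monomial ideal, and let $G$ be its (finite) minimal generating set of monomials. The Taylor symbols of $M$ are the subsets $\sigma\subseteq G$ (including $\varnothing$); the multidegree of $\sigma$ is $\operatorname{mdeg}\sigma=\operatorname{lcm}(\sigma)$ (with $\operatorname{lcm}(\varnothing)=1$) and its homological degree is $\operatorname{hdeg}\sigma=\#\sigma$. Let $L$ be the set of monomials $l$ such that the number of Taylor symbols of multidegree $l$ is odd, and for $l\in L$ put $$f(l)=\min\{\operatorname{hdeg}\sigma:\ \sigma\subseteq G,\ \operatorname{mdeg}\sigma=l\}.$$ For $k\ge 0$ and a monomial $l$, let $\beta_{k,l}(S/M)$ be the multigraded Betti number of $S/M$, that is, the number of basis elements of multidegree $l$ in homological degree $k$ of a minimal multigraded free resolution of $S/M$ (such a resolution exists, and the number does not depend on its choice). Theorem. Suppose that $M$ is almost generic, that is, there is an index $i\in\{1,\ldots,n\}$ such that no variable $x_j$ with $j\neq i$ appears with the same nonzero exponent in the factorizations of two distinct elements of $G$. Then $M$ has characteristic Betti numbers in minimal homological degrees: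 for all integers $k\ge 0$ and all monomials $l$, $$\beta_{k,l}(S/M)=\begin{cases}1 & \text{if } l\in L \text{ and } k=f(l),\\ 0 & \text{otherwise.}\end{cases}$$ -/

import Mathlib

open MvPolynomial

/-- The monomial `x ^ a` is identified with its exponent vector `a`; divisibility of monomials is
the order `≤` on exponent vectors and `lcm` is the supremum. An ideal of `S = K[x_1, …, x_n]` is a
monomial ideal if it is generated by monomials. -/
def IsMonomialIdeal {K : Type*} [Field K] {n : ℕ} (M : Ideal (MvPolynomial (Fin n) K)) : Prop :=
  ∃ A : Set (Fin n →₀ ℕ), M = Ideal.span ((fun a => monomial a (1 : K)) '' A)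

/-- The set of monomials of `M` that are minimal under divisibility. -/
def minimalMonomials {K : Type*} [Field K] {n : ℕ} (M : Ideal (MvPolynomial (Fin n) K)) :
    Set (Fin n →₀ ℕ) :=
  {a | Minimal (fun b : Fin n →₀ ℕ => monomial b (1 : K) ∈ M) a}

theorem minimalMonomials_finite {K : Type*} [Field K] {n : ℕ}
    (M : Ideal (MvPolynomial (Fin n) K)) : (minimalMonomials M).Finite :=
  IsAntichain.finite_of_wellQuasiOrdered
    (setOfPred_minimal_antichain (fun b : Fin n →₀ ℕ => monomial b (1 : K) ∈ M)) wellQuasiOrdered_le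

/-- The minimal generating set `G` of a monomial ideal. -/
noncomputable def minimalGenerators {K : Type*} [Field K] {n : ℕ}
    (M : Ideal (MvPolynomial (Fin n) K)) : Finset (Fin n →₀ ℕ) :=
  (minimalMonomials_finite M).toFinset

/-- A monomial ideal is generated by `minimalGenerators M`. -/
theorem span_minimalGenerators {K : Type*} [Field K] {n : ℕ}
    (M : Ideal (MvPolynomial (Fin n) K)) (hM : IsMonomialIdeal M) :
    Ideal.span ((fun a => monomial a (1 : K)) '' (minimalGenerators M : Set (Fin n →₀ ℕ))) = M := by
  apply le_antisymm
  · rw [Ideal.span_le]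
    rintro _ ⟨a, ha, rfl⟩
    have ha' : Minimal (fun b : Fin n →₀ ℕ => monomial b (1 : K) ∈ M) a := by
      simpa [minimalGenerators, minimalMonomials] using ha
    exact ha'.prop
  · obtain ⟨A, hA⟩ := hM
    conv_lhs => rw [hA]
    rw [Ideal.span_le]
    rintro _ ⟨a, ha, rfl⟩
    have haM : monomial a (1 : K) ∈ M := by
      rw [hA]
      exact Ideal.subset_span ⟨a, ha, rfl⟩
    obtain ⟨b, hba, hb⟩ :=
      exists_minimal_le_of_wellFoundedLT (fun b : Fin n →₀ ℕ => monomial b (1 : K) ∈ M) a haM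
    have hmul : monomial a (1 : K) = monomial (a - b) 1 * monomial b 1 := by
      rw [monomial_mul, one_mul, tsub_add_cancel_of_le hba]
    change monomial a (1 : K) ∈ _
    rw [hmul]
    refine Ideal.mul_mem_left _ _ (Ideal.subset_span ⟨b, ?_, rfl⟩)
    simpa [minimalGenerators, minimalMonomials] using hb

/-- There is a variable `x_i` such that no other variable appears with the same nonzero exponent
in two (distinct) minimal generators. -/
def IsAlmostGeneric {K : Type*} [Field K] {n : ℕ} (M : Ideal (MvPolynomial (Fin n) K)) : Prop :=
  ∃ i : Fin n, ∀ j : Fin n, j ≠ i → ∀ a ∈ minimalGenerators M, ∀ b ∈ minimalGenerators M,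
    a ≠ b → a j = b j → a j = 0

/-- The multidegree of a Taylor symbol `[σ]`: the `lcm` of its monomials. -/
noncomputable def taylorMdeg {n : ℕ} (σ : Finset (Fin n →₀ ℕ)) : Fin n →₀ ℕ := σ.sup id

/-- The basis elements of the Taylor resolution of `S / M` (the subsets of the minimal generating
set) of multidegree `l`. The homological degree of a symbol is its cardinality. -/
noncomputable def taylorSymbols {K : Type*} [Field K] {n : ℕ}
    (M : Ideal (MvPolynomial (Fin n) K)) (l : Fin n →₀ ℕ) : Finset (Finset (Fin n →₀ ℕ)) := by
  classical exact (minimalGenerators M).powerset.filter (fun σ => taylorMdeg σ = l)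

/-- The set `L` of multidegrees that are shared by an odd number of Taylor symbols. -/
def oddMultidegrees {K : Type*} [Field K] {n : ℕ} (M : Ideal (MvPolynomial (Fin n) K)) :
    Set (Fin n →₀ ℕ) :=
  {l | Odd (taylorSymbols M l).card}

/-- `f(l)`, the least homological degree of a Taylor symbol of multidegree `l`; it is used for
`l ∈ oddMultidegrees M` only, where such symbols exist. -/
noncomputable def minHomDeg {K : Type*} [Field K] {n : ℕ}
    (M : Ideal (MvPolynomial (Fin n) K)) (l : Fin n →₀ ℕ) : ℕ :=
  sInf {k | ∃ σ ∈ taylorSymbols M l, σ.card = k}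

/-- A multigraded free resolution `⋯ → F_1 → F_0 → S / M → 0` by free modules of finite rank, in
coordinates: `F_i` has the homogeneous basis `ι i`, with multidegrees `mdeg i`; the map
`F_{i+1} → F_i` has the matrix `d i`; the map `F_0 → S / M` sends the basis element `τ` to `aug τ`.
That the maps preserve multidegrees means that the entry in row `σ` and column `τ` is a scalar
multiple of the monomial `mdeg τ / mdeg σ`, and zero if `mdeg σ` does not divide `mdeg τ`. -/
structure MultigradedFreeResolution {K : Type*} [Field K] {n : ℕ}
    (M : Ideal (MvPolynomial (Fin n) K)) where
  ι : ℕ → Type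
  fintype_ι : ∀ i, Fintype (ι i)
  mdeg : ∀ i, ι i → (Fin n →₀ ℕ)
  d : ∀ i, Matrix (ι i) (ι (i + 1)) (MvPolynomial (Fin n) K)
  aug : ι 0 → MvPolynomial (Fin n) K ⧸ M
  d_homogeneous : ∀ i σ τ, ∃ c : K,
    d i σ τ * monomial (mdeg i σ) 1 = monomial (mdeg (i + 1) τ) c
  aug_homogeneous : ∀ τ, ∃ c : K, aug τ = Ideal.Quotient.mk M (monomial (mdeg 0 τ) c)
  aug_surjective :
    Function.Surjective (Fintype.linearCombination (MvPolynomial (Fin n) K) aug)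
  exact_zero : Function.Exact (d 0).mulVecLin
    (Fintype.linearCombination (MvPolynomial (Fin n) K) aug)
  exact_succ : ∀ i, Function.Exact (d (i + 1)).mulVecLin (d i).mulVecLin

attribute [instance] MultigradedFreeResolution.fintype_ι

/-- The resolution is minimal: no differential matrix has an invertible entry. -/
def MultigradedFreeResolution.IsMinimal {K : Type*} [Field K] {n : ℕ}
    {M : Ideal (MvPolynomial (Fin n) K)} (F : MultigradedFreeResolution M) : Prop :=
  ∀ i σ τ, ¬ IsUnit (F.d i σ τ)

/-- The number of basis elements of `F_k` of multidegree `l`. -/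
noncomputable def MultigradedFreeResolution.basisCount {K : Type*} [Field K] {n : ℕ}
    {M : Ideal (MvPolynomial (Fin n) K)} (F : MultigradedFreeResolution M)
    (k : ℕ) (l : Fin n →₀ ℕ) : ℕ :=
  Nat.card {σ : F.ι k // F.mdeg k σ = l}

/-- The multigraded Betti number of `S / M` in homological degree `k` and multidegree `l` equals
`b`: a minimal multigraded free resolution of `S / M` exists, and every one of them has exactly `b`
basis elements of multidegree `l` in homological degree `k`. -/
def MultigradedBettiEq {K : Type*} [Field K] {n : ℕ} (M : Ideal (MvPolynomial (Fin n) K))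
    (k : ℕ) (l : Fin n →₀ ℕ) (b : ℕ) : Prop :=
  (∃ F : MultigradedFreeResolution M, F.IsMinimal) ∧
    ∀ F : MultigradedFreeResolution M, F.IsMinimal → F.basisCount k l = b

open scoped Classical in
/-- The multigraded Betti number of `S / M` is `1` in homological degree `k` and multidegree `l` if
`l ∈ L` and `k = f(l)`, and it is `0` otherwise. -/
def HasCharacteristicBettiInMinimalHomDegrees {K : Type*} [Field K] {n : ℕ}
    (M : Ideal (MvPolynomial (Fin n) K)) : Prop :=
  ∀ (k : ℕ) (l : Fin n →₀ ℕ),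
    MultigradedBettiEq M k l (if l ∈ oddMultidegrees M ∧ k = minHomDeg M l then 1 else 0)

/-! ### Coordinate spaces filtered by degrees -/

/-! In multidegree `l`, the number of basis elements of a minimal resolution in homological degree
`k` is the dimension of a homology space: take the strand of vectors of degree at most `l`, divide
by those of degree less than `l`, and take homology at `k`. Resolutions are homotopy equivalent
through degree-preserving maps, so any resolution computes this dimension
(`StrandResolution.IsMinimal.card_eq`). For the Taylor resolution the quotient strand has as basis
the subsets of `G` with lcm `l`.

These subsets are very restricted (`multidegree_cases_of_almostGeneric`). Assume that there is one,
and let `A` consist of the generators dividing `l` that have the same nonzero exponent as `l` at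
some `j ≠ i`. Almost genericity makes each of them the only generator with that exponent, so every
subset of multidegree `l` contains `A`; and `A` attains every nonzero exponent of `l` away from `i`.
Hence a set of generators dividing `l` has multidegree `l` exactly when it contains `A` and attains
`l i` (no condition if `l i = 0`).

If some generator `v` dividing `l` can always be erased without changing the multidegree, the cone
over `v` kills all homology, and toggling `v` shows that the number of subsets is even. Otherwise
there is either a single subset, which gives one class in its own cardinality, or the subsets are `A
∪ B'` with `∅ ≠ B' ⊆ B` for a nonempty `B`. The interval from `A` to `A ∪ B` is acyclic and only its
bottom is missing, so exactly one class remains, in homological degree `#A + 1`; the number `2 ^ #B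
- 1` of subsets is odd and `#A + 1` is the least cardinality. This is the formula to be proved.

A minimal resolution exists because syzygies can be generated degree by degree by complements of
what comes from lower degrees. Scalar matrices and matrices of polynomials determine each other by
homogeneity (`exact_iff_strand_exact`). -/

section Graded

variable {K : Type*} [Field K] {D : Type*} [PartialOrder D]

/-- The vectors whose nonzero coordinates have degrees in `s`. -/
def supportedIn (K : Type*) [Field K] {D ι : Type*} (deg : ι → D) (s : Set D) :
    Submodule K (ι → K) where
  carrier := {v | ∀ σ, v σ ≠ 0 → deg σ ∈ s}
  add_mem' := by
    intro v w hv hw σ h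
    by_cases h' : v σ = 0
    · exact hw σ fun h'' => h (by simp [h', h''])
    · exact hv σ h'
  zero_mem' := by simp
  smul_mem' := by
    intro c v hv σ h
    exact hv σ fun h' => h (by simp [h'])

theorem supportedIn_mono {D ι : Type*} {deg : ι → D} {s t : Set D} (h : s ⊆ t) :
    supportedIn K deg s ≤ supportedIn K deg t := fun _ hv σ hσ => h (hv σ hσ)

theorem single_mem_supportedIn {D ι : Type*} [DecidableEq ι] {deg : ι → D} {s : Set D} {τ : ι}
    (h : deg τ ∈ s) (c : K) : Pi.single τ c ∈ supportedIn K deg s := by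
  intro σ hσ
  by_cases hστ : σ = τ
  · exact hστ ▸ h
  · exact absurd (by simp [hστ]) hσ

theorem supportedIn_le_of_single {D ι : Type*} [Fintype ι] [DecidableEq ι] {deg : ι → D}
    {s : Set D} {P : Submodule K (ι → K)} (h : ∀ τ, deg τ ∈ s → Pi.single τ (1 : K) ∈ P) :
    supportedIn K deg s ≤ P := by
  intro v hv
  rw [pi_eq_sum_univ' v]
  refine P.sum_mem fun τ _ => ?_
  by_cases h0 : v τ = 0
  · simp [h0]
  · have := P.smul_mem (v τ) (h τ (hv τ h0))
    convert this using 2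

/-- A linear map between coordinate spaces preserves the filtration by degrees. -/
def IsGraded {ι κ : Type*} (deg : ι → D) (deg' : κ → D) (f : (ι → K) →ₗ[K] (κ → K)) : Prop :=
  ∀ a, ∀ v ∈ supportedIn K deg (Set.Iic a), f v ∈ supportedIn K deg' (Set.Iic a)

theorem IsGraded.mem_Iio {ι κ : Type*} [Fintype ι] {deg : ι → D} {deg' : κ → D}
    {f : (ι → K) →ₗ[K] (κ → K)} (hf : IsGraded deg deg' f) {l : D} {v : ι → K}
    (hv : v ∈ supportedIn K deg (Set.Iio l)) : f v ∈ supportedIn K deg' (Set.Iio l) := by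
  classical
  have : supportedIn K deg (Set.Iio l) ≤ (supportedIn K deg' (Set.Iio l)).comap f := by
    refine supportedIn_le_of_single fun τ hτ => ?_
    exact supportedIn_mono (Set.Iic_subset_Iio.2 hτ)
      (hf (deg τ) _ (single_mem_supportedIn (Set.mem_Iic.2 le_rfl) 1))
  exact this hv

theorem exists_isGraded {ι κ : Type*} [Fintype ι] [DecidableEq ι] {deg : ι → D} {deg' : κ → D}
    {P : ι → (κ → K) → Prop}
    (h : ∀ τ, ∃ y ∈ supportedIn K deg' (Set.Iic (deg τ)), P τ y) :
    ∃ f : (ι → K) →ₗ[K] (κ → K), IsGraded deg deg' f ∧ ∀ τ, P τ (f (Pi.single τ 1)) := by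
  choose y hy hP using h
  have hs : ∀ τ, Fintype.linearCombination K y (Pi.single τ 1) = y τ := fun τ => by
    rw [Fintype.linearCombination_apply_single, one_smul]
  refine ⟨Fintype.linearCombination K y, fun a => ?_, fun τ => (hs τ).symm ▸ hP τ⟩
  have : supportedIn K deg (Set.Iic a) ≤
      (supportedIn K deg' (Set.Iic a)).comap (Fintype.linearCombination K y) := by
    refine supportedIn_le_of_single fun τ hτ => ?_
    rw [Submodule.mem_comap, hs]
    exact supportedIn_mono (Set.Iic_subset_Iic.2 hτ) (hy τ)
  exact this

/-- Dependent choice for chain maps, homotopies and resolutions: `P` is the invariant that keeps the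
construction going, `R` the relation wanted between consecutive terms. -/
theorem exists_seq_of_step {α : ℕ → Type*} {P : ∀ i, α i → Prop} {R : ∀ i, α i → α (i + 1) → Prop}
    {Q : α 0 → Prop} (h0 : ∃ x, P 0 x ∧ Q x)
    (hs : ∀ i x, P i x → ∃ y, P (i + 1) y ∧ R i x y) :
    ∃ x : ∀ i, α i, (∀ i, P i (x i)) ∧ Q (x 0) ∧ ∀ i, R i (x i) (x (i + 1)) := by
  choose next hP hR using hs
  obtain ⟨x0, hx0, hQ⟩ := h0
  let s : ∀ i, {x : α i // P i x} := fun i =>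
    Nat.rec ⟨x0, hx0⟩ (fun i x => ⟨next i x.1 x.2, hP i x.1 x.2⟩) i
  exact ⟨fun i => (s i).1, fun i => (s i).2, hQ, fun i => hR i _ (s i).2⟩

end Graded

/-- A multigraded free resolution of `S / M` reduced to scalar matrices: the component of
degree `a` of the `i`-th free module is spanned by the basis elements of degree at most `a`, and
the complex is exact in each degree. The set `U` consists of the degrees of the monomials in `M`. -/
structure StrandResolution (K : Type*) [Field K] {D : Type*} [PartialOrder D] (U : Set D) where
  ι : ℕ → Type
  fintype_ι : ∀ i, Fintype (ι i)
  deg : ∀ i, ι i → D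
  d : ∀ i, (ι (i + 1) → K) →ₗ[K] (ι i → K)
  ε : (ι 0 → K) →ₗ[K] K
  graded : ∀ i, IsGraded (deg (i + 1)) (deg i) (d i)
  surjective : ∀ a ∉ U, ∃ v ∈ supportedIn K (deg 0) (Set.Iic a), ε v = 1
  exact_zero : ∀ a, ∀ v ∈ supportedIn K (deg 0) (Set.Iic a),
    (a ∈ U ∨ ε v = 0) ↔ ∃ w ∈ supportedIn K (deg 1) (Set.Iic a), d 0 w = v
  exact_succ : ∀ i a, ∀ v ∈ supportedIn K (deg (i + 1)) (Set.Iic a),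
    d i v = 0 ↔ ∃ w ∈ supportedIn K (deg (i + 2)) (Set.Iic a), d (i + 1) w = v

/-! ### Comparison of resolutions and homology modulo lower degrees. -/

namespace StrandResolution

attribute [instance] StrandResolution.fintype_ι

variable {K : Type*} [Field K] {D : Type*} [PartialOrder D] {U : Set D}

/-- The vectors of degree at most `a`. -/
abbrev le (F : StrandResolution K U) (i : ℕ) (a : D) : Submodule K (F.ι i → K) :=
  supportedIn K (F.deg i) (Set.Iic a)

/-- The vectors of degree less than `a`. -/
abbrev lt (F : StrandResolution K U) (i : ℕ) (a : D) : Submodule K (F.ι i → K) :=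
  supportedIn K (F.deg i) (Set.Iio a)

/-- The condition on a vector of degree at most `a` to be the boundary of such a vector. -/
def IsCycle (F : StrandResolution K U) (a : D) : ∀ i, (F.ι i → K) → Prop
  | 0, v => a ∈ U ∨ F.ε v = 0
  | i + 1, v => F.d i v = 0

theorem isCycle_iff (F : StrandResolution K U) {a : D} {i : ℕ} {v : F.ι i → K}
    (hv : v ∈ F.le i a) : F.IsCycle a i v ↔ ∃ w ∈ F.le (i + 1) a, F.d i w = v := by
  cases i with
  | zero => exact F.exact_zero a v hv
  | succ i => exact F.exact_succ i a v hv

theorem d_d (F : StrandResolution K U) (i : ℕ) (v : F.ι (i + 2) → K) :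
    F.d i (F.d (i + 1) v) = 0 := by
  classical
  have : F.d i ∘ₗ F.d (i + 1) = 0 := by
    refine LinearMap.pi_ext' fun τ => LinearMap.ext_ring ?_
    have hτ : (Pi.single τ 1 : F.ι (i + 2) → K) ∈ F.le (i + 2) (F.deg _ τ) :=
      single_mem_supportedIn (Set.mem_Iic.2 le_rfl) 1
    exact (F.exact_succ i _ _ (F.graded _ _ _ hτ)).2 ⟨_, hτ, rfl⟩
  exact LinearMap.congr_fun this v

/-- Maps of resolutions that lift the identity of `S / M`. -/
structure IsChainMap (F G : StrandResolution K U)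
    (φ : ∀ i, (F.ι i → K) →ₗ[K] (G.ι i → K)) : Prop where
  graded : ∀ i, IsGraded (F.deg i) (G.deg i) (φ i)
  comm : ∀ i v, G.d i (φ (i + 1) v) = φ i (F.d i v)
  aug : ∀ a ∉ U, ∀ v ∈ F.le 0 a, G.ε (φ 0 v) = F.ε v

theorem IsChainMap.comp {F G H : StrandResolution K U}
    {φ : ∀ i, (F.ι i → K) →ₗ[K] (G.ι i → K)} {ψ : ∀ i, (G.ι i → K) →ₗ[K] (H.ι i → K)}
    (hψ : IsChainMap G H ψ) (hφ : IsChainMap F G φ) :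
    IsChainMap F H (fun i => ψ i ∘ₗ φ i) where
  graded i a v hv := hψ.graded i a _ (hφ.graded i a v hv)
  comm i v := by simp [hψ.comm, hφ.comm]
  aug a ha v hv := by
    simp only [LinearMap.comp_apply]
    rw [hψ.aug a ha _ (hφ.graded 0 a v hv), hφ.aug a ha v hv]

/-- Images of basis vectors are lifted one homological degree at a time by exactness in the degree
of each vector. The invariant is that cycles go to cycles; for degrees in `U` the component of `S /
M` is zero, so every vector at position zero is a cycle. -/
theorem exists_isChainMap (F G : StrandResolution K U) (hU : IsUpperSet U) :
    ∃ φ, IsChainMap F G φ := by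
  classical
  have key := exists_seq_of_step
    (α := fun i => (F.ι i → K) →ₗ[K] (G.ι i → K))
    (P := fun i φ => IsGraded (F.deg i) (G.deg i) φ ∧
      ∀ a, ∀ v ∈ F.le i a, F.IsCycle a i v → G.IsCycle a i (φ v))
    (Q := fun φ => ∀ a ∉ U, ∀ v ∈ F.le 0 a, G.ε (φ v) = F.ε v)
    (R := fun i φ φ' => ∀ v, G.d i (φ' v) = φ (F.d i v)) ?_ ?_
  · obtain ⟨φ, h1, h0, h2⟩ := key
    exact ⟨φ, fun i => (h1 i).1, h2, h0⟩
  · obtain ⟨φ, hφ, hP⟩ := exists_isGraded (deg := F.deg 0) (deg' := G.deg 0)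
      (P := fun τ y => F.deg 0 τ ∉ U → G.ε y = F.ε (Pi.single τ 1)) (fun τ => by
        by_cases hτ : F.deg 0 τ ∈ U
        · exact ⟨0, Submodule.zero_mem _, fun h => absurd hτ h⟩
        · obtain ⟨v, hv, h1⟩ := G.surjective _ hτ
          exact ⟨F.ε (Pi.single τ 1) • v, Submodule.smul_mem _ _ hv, fun _ => by simp [h1]⟩)
    have haug : ∀ a ∉ U, ∀ v ∈ F.le 0 a, G.ε (φ v) = F.ε v := by
      intro a ha
      have : F.le 0 a ≤ LinearMap.eqLocus (G.ε ∘ₗ φ) F.ε :=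
        supportedIn_le_of_single fun τ hτ => hP τ fun h => ha (hU hτ h)
      exact this
    refine ⟨φ, ⟨hφ, fun a v hv h => ?_⟩, haug⟩
    by_cases ha : a ∈ U
    · exact Or.inl ha
    · exact Or.inr ((haug a ha v hv).trans (h.resolve_left ha))
  · rintro i φ ⟨hφ, hc⟩
    obtain ⟨φ', hφ', hP⟩ := exists_isGraded (deg := F.deg (i + 1)) (deg' := G.deg (i + 1))
      (P := fun τ y => G.d i y = φ (F.d i (Pi.single τ 1))) (fun τ => by
        have hτ : (Pi.single τ 1 : F.ι (i + 1) → K) ∈ F.le (i + 1) (F.deg _ τ) :=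
          single_mem_supportedIn (Set.mem_Iic.2 le_rfl) 1
        have hd := F.graded i _ _ hτ
        exact (G.isCycle_iff (hφ _ _ hd)).1 (hc _ _ hd ((F.isCycle_iff hd).2 ⟨_, hτ, rfl⟩)))
    have hcomm : ∀ v, G.d i (φ' v) = φ (F.d i v) := by
      have : G.d i ∘ₗ φ' = φ ∘ₗ F.d i :=
        LinearMap.pi_ext' fun τ => LinearMap.ext_ring (hP τ)
      exact LinearMap.congr_fun this
    refine ⟨φ', ⟨hφ', fun a v hv h => ?_⟩, hcomm⟩
    have h' : F.d i v = 0 := h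
    change G.d i (φ' v) = 0
    rw [hcomm, h', map_zero]

/-- The invariant on `h` is exactly what makes `θ v - v - h (d v)` a cycle one step further, so that
exactness supplies the next value. -/
theorem IsChainMap.exists_homotopy {F : StrandResolution K U}
    {θ : ∀ i, (F.ι i → K) →ₗ[K] (F.ι i → K)}
    (hθ : IsChainMap F F θ) :
    ∃ h : ∀ i, (F.ι i → K) →ₗ[K] (F.ι (i + 1) → K),
      (∀ i, IsGraded (F.deg i) (F.deg (i + 1)) (h i)) ∧
      (∀ v, F.d 0 (h 0 v) = θ 0 v - v) ∧
      ∀ i v, F.d (i + 1) (h (i + 1) v) = θ (i + 1) v - v - h i (F.d i v) := by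
  classical
  have key := exists_seq_of_step
    (α := fun i => (F.ι i → K) →ₗ[K] (F.ι (i + 1) → K))
    (P := fun i h => IsGraded (F.deg i) (F.deg (i + 1)) h ∧
      ∀ v, F.d i (h (F.d i v)) = θ i (F.d i v) - F.d i v)
    (Q := fun h => ∀ v, F.d 0 (h v) = θ 0 v - v)
    (R := fun i h h' => ∀ v, F.d (i + 1) (h' v) = θ (i + 1) v - v - h (F.d i v)) ?_ ?_
  · obtain ⟨h, h1, h0, h2⟩ := key
    exact ⟨h, fun i => (h1 i).1, h0, h2⟩
  · obtain ⟨h, hh, hP⟩ := exists_isGraded (deg := F.deg 0) (deg' := F.deg 1)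
      (P := fun τ y => F.d 0 y = θ 0 (Pi.single τ 1) - Pi.single τ 1) (fun τ => by
        have hτ : (Pi.single τ 1 : F.ι 0 → K) ∈ F.le 0 (F.deg _ τ) :=
          single_mem_supportedIn (Set.mem_Iic.2 le_rfl) 1
        refine (F.isCycle_iff (Submodule.sub_mem _ (hθ.graded 0 _ _ hτ) hτ)).1 ?_
        by_cases ha : F.deg 0 τ ∈ U
        · exact Or.inl ha
        · exact Or.inr (by rw [map_sub, hθ.aug _ ha _ hτ, sub_self]))
    have h0 : ∀ v, F.d 0 (h v) = θ 0 v - v := by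
      have : F.d 0 ∘ₗ h = θ 0 - LinearMap.id :=
        LinearMap.pi_ext' fun τ => LinearMap.ext_ring (hP τ)
      exact LinearMap.congr_fun this
    exact ⟨h, ⟨hh, fun v => h0 _⟩, h0⟩
  · rintro i h ⟨hh, hc⟩
    obtain ⟨h', hh', hP⟩ := exists_isGraded (deg := F.deg (i + 1)) (deg' := F.deg (i + 2))
      (P := fun τ y => F.d (i + 1) y =
        θ (i + 1) (Pi.single τ 1) - Pi.single τ 1 - h (F.d i (Pi.single τ 1))) (fun τ => by
        have hτ : (Pi.single τ 1 : F.ι (i + 1) → K) ∈ F.le (i + 1) (F.deg _ τ) :=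
          single_mem_supportedIn (Set.mem_Iic.2 le_rfl) 1
        refine (F.isCycle_iff (Submodule.sub_mem _ (Submodule.sub_mem _ (hθ.graded _ _ _ hτ) hτ)
          (hh _ _ (F.graded i _ _ hτ)))).1 ?_
        change F.d i _ = 0
        rw [map_sub, map_sub, hc, hθ.comm, sub_self])
    have h0 : ∀ v, F.d (i + 1) (h' v) = θ (i + 1) v - v - h (F.d i v) := by
      have : F.d (i + 1) ∘ₗ h' = θ (i + 1) - LinearMap.id - h ∘ₗ F.d i :=
        LinearMap.pi_ext' fun τ => LinearMap.ext_ring (hP τ)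
      exact LinearMap.congr_fun this
    refine ⟨h', ⟨hh', fun v => ?_⟩, h0⟩
    rw [h0, F.d_d, map_zero, sub_zero]

/-- Cycles of degree `l` modulo the vectors of degree less than `l`. -/
def IsRelCycle (F : StrandResolution K U) (l : D) : ∀ i, (F.ι i → K) → Prop
  | 0, _ => True
  | i + 1, v => F.d i v ∈ F.lt i l

theorem IsChainMap.isRelCycle {F G : StrandResolution K U}
    {φ : ∀ i, (F.ι i → K) →ₗ[K] (G.ι i → K)} (hφ : IsChainMap F G φ) {l : D} {i : ℕ}
    {v : F.ι i → K} (hv : F.IsRelCycle l i v) : G.IsRelCycle l i (φ i v) := by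
  cases i with
  | zero => trivial
  | succ i =>
    change G.d i _ ∈ _
    rw [hφ.comm]
    exact (hφ.graded i).mem_Iio hv

/-- With a homotopy `h`, the difference `θ v - v` is `d (h v) + h (d v)`, and the last term has
lower degree when `v` is a relative cycle. -/
theorem IsChainMap.exists_sub_mem_lt {F : StrandResolution K U}
    {θ : ∀ i, (F.ι i → K) →ₗ[K] (F.ι i → K)} (hθ : IsChainMap F F θ) {l : D} {i : ℕ}
    {v : F.ι i → K} (hv : v ∈ F.le i l) (hc : F.IsRelCycle l i v) :
    ∃ w ∈ F.le (i + 1) l, θ i v - v - F.d i w ∈ F.lt i l := by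
  obtain ⟨h, hg, h0, h1⟩ := hθ.exists_homotopy
  refine ⟨h i v, hg i l v hv, ?_⟩
  cases i with
  | zero => simp [h0]
  | succ i =>
    rw [h1, sub_sub_cancel]
    exact (hg i).mem_Iio hc

/-- The homology of degree `l` at `i`, modulo the vectors of degree less than `l`, has
dimension `b`. -/
def RelHomologyDim (F : StrandResolution K U) (i : ℕ) (l : D) (b : ℕ) : Prop :=
  ∃ f : (F.ι i → K) →ₗ[K] (Fin b → K),
    (∀ v ∈ F.lt i l, f v = 0) ∧ (∀ w ∈ F.le (i + 1) l, f (F.d i w) = 0) ∧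
    (∀ v ∈ F.le i l, F.IsRelCycle l i v → f v = 0 → ∃ w ∈ F.le (i + 1) l, v - F.d i w ∈ F.lt i l) ∧
    ∀ c, ∃ v ∈ F.le i l, F.IsRelCycle l i v ∧ f v = c

/-- The differentials vanish modulo the vectors of lower degrees. -/
def IsMinimal (F : StrandResolution K U) : Prop :=
  ∀ i l, ∀ v ∈ F.le (i + 1) l, F.d i v ∈ F.lt i l

/-- In a minimal `F` all differentials vanish modulo lower degrees, so its relative homology is the
span of the basis elements of degree `l`. Comparison maps in both directions, inverse up to
homotopy, identify it with that of `G`. -/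
theorem IsMinimal.card_eq {F G : StrandResolution K U} (hU : IsUpperSet U) (hF : F.IsMinimal)
    {i : ℕ} {l : D} {b : ℕ} (hG : G.RelHomologyDim i l b) :
    Nat.card {σ : F.ι i // F.deg i σ = l} = b := by
  classical
  obtain ⟨φ, hφ⟩ := exists_isChainMap F G hU
  obtain ⟨ψ, hψ⟩ := exists_isChainMap G F hU
  obtain ⟨f, f1, f2, f3, f4⟩ := hG
  have hrel : ∀ v ∈ F.le i l, F.IsRelCycle l i v := by
    intro v hv
    cases i with
    | zero => trivial
    | succ i => exact hF i l v hv
  let e : ({σ : F.ι i // F.deg i σ = l} → K) →ₗ[K] (F.ι i → K) :=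
    Function.ExtendByZero.linearMap K Subtype.val
  have he_apply : ∀ x (σ : {σ : F.ι i // F.deg i σ = l}), e x σ = x σ := fun x σ =>
    Function.Injective.extend_apply Subtype.val_injective _ _ _
  have he_zero : ∀ x (σ : F.ι i), F.deg i σ ≠ l → e x σ = 0 := fun x σ hσ =>
    Function.extend_apply' _ _ _ (by rintro ⟨⟨τ, hτ⟩, rfl⟩; exact hσ hτ)
  have hele : ∀ x, e x ∈ F.le i l := by
    intro x σ hσ
    by_contra h
    exact hσ (he_zero x σ fun h' => h h'.le)
  have hbij : Function.Bijective (f ∘ₗ φ i ∘ₗ e) := by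
    constructor
    · rw [injective_iff_map_eq_zero]
      intro x hx
      have hφx := hφ.graded i l _ (hele x)
      obtain ⟨w, hw, hvw⟩ := f3 _ hφx (hφ.isRelCycle (hrel _ (hele x))) hx
      obtain ⟨w', hw', hvw'⟩ := (hψ.comp hφ).exists_sub_mem_lt (hele x) (hrel _ (hele x))
      have h1 := (hψ.graded i).mem_Iio hvw
      rw [map_sub, ← hψ.comm] at h1
      have h2 := hF i l _ (hψ.graded _ l _ hw)
      have h3 := hF i l _ hw'
      have h4 : e x ∈ F.lt i l := by
        have := Submodule.sub_mem _ (Submodule.sub_mem _ (Submodule.add_mem _ h1 h2) hvw') h3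
        simp only [LinearMap.comp_apply] at this
        convert this using 1
        abel
      ext ⟨σ, hσ⟩
      by_contra h
      rw [← he_apply x] at h
      exact (h4 σ h).ne hσ
    · intro c
      obtain ⟨z, hz, hzc, rfl⟩ := f4 c
      obtain ⟨w, hw, hvw⟩ := (hφ.comp hψ).exists_sub_mem_lt hz hzc
      -- The preimage is the degree `l` part of `ψ z`; what is discarded has lower degree and is
      -- invisible to `f`.
      refine ⟨fun σ => ψ i z σ, ?_⟩
      have h1 : ψ i z - e (fun σ => ψ i z σ) ∈ F.lt i l := by
        intro σ hσ
        refine lt_of_le_of_ne ?_ fun h => hσ ?_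
        · exact Submodule.sub_mem _ (hψ.graded i l _ hz) (hele _) σ hσ
        · have := he_apply (fun σ => ψ i z σ) ⟨σ, h⟩
          simp only at this
          rw [Pi.sub_apply, this, sub_self]
      have h2 := f1 _ ((hφ.graded i).mem_Iio h1)
      have h3 := f1 _ hvw
      rw [map_sub, map_sub, sub_eq_zero] at h2
      rw [map_sub, map_sub, f2 w hw, sub_zero, sub_eq_zero] at h3
      exact h2.symm.trans h3
  have := LinearEquiv.finrank_eq (LinearEquiv.ofBijective _ hbij)
  simpa [Nat.card_eq_fintype_card] using this

end StrandResolution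

/-! ### Existence of minimal resolutions -/

/-- The components of a multigraded submodule of a free module, which is contained in the
product of the module with the maximal ideal and has generators in finitely many degrees only. -/
structure SyzygyFamily (K : Type*) [Field K] (D : Type) [PartialOrder D] where
  ι : Type
  fintype_ι : Fintype ι
  deg : ι → D
  Z : D → Submodule K (ι → K)
  mono : Monotone Z
  le_lt : ∀ a, Z a ≤ supportedIn K deg (Set.Iio a)
  jumps : Finset D
  le_iSup : ∀ a ∉ jumps, Z a ≤ ⨆ b : Set.Iio a, Z b

namespace SyzygyFamily

attribute [instance] SyzygyFamily.fintype_ι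

variable {K : Type*} [Field K] {D : Type}

/-- One step of the minimal resolution. The new basis elements of degree `a` are a basis of a
complement `C a` of the contributions from below in `Z a`; this is nonzero for `a ∈ jumps` only, so
the basis is finite. -/
theorem exists_next [SemilatticeSup D] [OrderBot D] [WellFoundedLT D] (s : SyzygyFamily K D) :
    ∃ (t : SyzygyFamily K D) (d : (t.ι → K) →ₗ[K] (s.ι → K)),
      (∀ a, (supportedIn K t.deg (Set.Iic a)).map d = s.Z a) ∧
      ∀ a, t.Z a = supportedIn K t.deg (Set.Iic a) ⊓ LinearMap.ker d := by
  classical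
  have hC : ∀ a, ∃ C : Submodule K (s.ι → K),
      (⨆ b : Set.Iio a, s.Z b) ⊓ C = ⊥ ∧ (⨆ b : Set.Iio a, s.Z b) ⊔ C = s.Z a := by
    intro a
    have hle : (⨆ b : Set.Iio a, s.Z b) ≤ s.Z a := iSup_le fun b => s.mono b.2.le
    obtain ⟨C', hC'⟩ := Submodule.exists_isCompl (⨆ b : Set.Iio a, s.Z b)
    refine ⟨C' ⊓ s.Z a, ?_, ?_⟩
    · rw [← inf_assoc, hC'.inf_eq_bot, bot_inf_eq]
    · rw [← sup_inf_assoc_of_le _ hle, hC'.sup_eq_top, top_inf_eq]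
  choose C hCinf hCsup using hC
  let ι' : Type := Σ a : s.jumps, Fin (Module.finrank K (C a))
  let deg' : ι' → D := fun τ => τ.1
  let g : ι' → (s.ι → K) := fun τ => (Module.finBasis K (C τ.1) τ.2 : s.ι → K)
  let d : (ι' → K) →ₗ[K] (s.ι → K) := Fintype.linearCombination K g
  have hds : ∀ τ, d (Pi.single τ 1) = g τ := fun τ => by
    change Fintype.linearCombination K g _ = _
    rw [Fintype.linearCombination_apply_single, one_smul]
  have hCZ : ∀ a, C a ≤ s.Z a := fun a => hCsup a ▸ le_sup_right
  have hgC : ∀ τ, g τ ∈ C τ.1 := fun τ => (Module.finBasis K (C τ.1) τ.2).2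
  have hmap : ∀ a, (supportedIn K deg' (Set.Iic a)).map d = s.Z a := by
    intro a
    apply le_antisymm
    · rw [Submodule.map_le_iff_le_comap]
      refine supportedIn_le_of_single fun τ hτ => ?_
      rw [Submodule.mem_comap, hds]
      exact s.mono hτ (hCZ _ (hgC τ))
    · induction a using WellFoundedLT.induction with
      | ind a ih =>
        rw [← hCsup a]
        refine sup_le (iSup_le fun b => (ih b b.2).trans
          (Submodule.map_mono (supportedIn_mono (Set.Iic_subset_Iic.2 (le_of_lt b.2))))) ?_
        by_cases ha : a ∈ s.jumps
        · intro x hx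
          have h1 := (Module.finBasis K (C a)).sum_repr ⟨x, hx⟩
          have h2 : x = ∑ j, (Module.finBasis K (C a)).repr ⟨x, hx⟩ j • g ⟨⟨a, ha⟩, j⟩ := by
            have := congrArg Subtype.val h1
            rw [AddSubmonoidClass.coe_finsetSum] at this
            exact this.symm
          rw [h2]
          refine Submodule.sum_mem _ fun j _ => Submodule.smul_mem _ _ ?_
          exact ⟨_, single_mem_supportedIn (Set.mem_Iic.2 le_rfl) 1, hds _⟩
        · have : C a = ⊥ := by
            rw [← hCinf a, eq_comm, inf_eq_right]
            exact (hCZ a).trans (s.le_iSup a ha)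
          rw [this]
          exact bot_le
  -- The part of a relation that uses generators of degree `a` lies in `C a` and, by the relation,
  -- also in the sum of the lower components. Hence it is zero, and linear independence kills its
  -- coefficients.
  have hmin : ∀ a, supportedIn K deg' (Set.Iic a) ⊓ LinearMap.ker d ≤
      supportedIn K deg' (Set.Iio a) := by
    rintro a x ⟨hx, hdx⟩ ⟨b, j⟩ hσ
    refine lt_of_le_of_ne (hx _ hσ) ?_
    intro hba
    change (b : D) = a at hba
    subst hba
    let y : s.ι → K := ∑ k, x ⟨b, k⟩ • g ⟨b, k⟩
    have hy : y ∈ C b := Submodule.sum_mem _ fun k _ => Submodule.smul_mem _ _ (hgC ⟨b, k⟩)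
    have hsum : d x = ∑ c : s.jumps, ∑ k, x ⟨c, k⟩ • g ⟨c, k⟩ := by
      change Fintype.linearCombination K g x = _
      rw [Fintype.linearCombination_apply, Fintype.sum_sigma]
    rw [← Finset.add_sum_erase _ _ (Finset.mem_univ b)] at hsum
    have hrest : ∑ c ∈ Finset.univ.erase b, ∑ k, x ⟨c, k⟩ • g ⟨c, k⟩ ∈
        ⨆ c : Set.Iio (b : D), s.Z c := by
      refine Submodule.sum_mem _ fun c hc => Submodule.sum_mem _ fun k _ => ?_
      by_cases h0 : x ⟨c, k⟩ = 0
      · simp [h0]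
      · have hlt : (c : D) < b :=
          lt_of_le_of_ne (hx _ h0) fun h => (Finset.mem_erase.1 hc).1 (Subtype.ext h)
        exact Submodule.smul_mem _ _ (Submodule.mem_iSup_of_mem (⟨c, hlt⟩ : Set.Iio (b : D))
          (hCZ _ (hgC ⟨c, k⟩)))
    have hy0 : y = 0 := by
      have h1 : y ∈ ⨆ c : Set.Iio (b : D), s.Z c := by
        rw [show d x = 0 from hdx] at hsum
        rw [show y = _ from eq_neg_of_add_eq_zero_left hsum.symm]
        exact Submodule.neg_mem _ hrest
      have : y ∈ (⨆ c : Set.Iio (b : D), s.Z c) ⊓ C b := ⟨h1, hy⟩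
      rw [hCinf] at this
      exact this
    have hlin := (Module.finBasis K (C b)).linearIndependent
    rw [Fintype.linearIndependent_iff] at hlin
    refine hσ (hlin (fun k => x ⟨b, k⟩) (Subtype.ext ?_) j)
    rw [AddSubmonoidClass.coe_finsetSum]
    exact hy0
  refine ⟨{ ι := ι'
            fintype_ι := inferInstance
            deg := deg'
            Z := fun a => supportedIn K deg' (Set.Iic a) ⊓ LinearMap.ker d
            mono := fun a b hab =>
              inf_le_inf_right _ (supportedIn_mono (Set.Iic_subset_Iic.2 hab))
            le_lt := hmin
            -- Let `b` be the join of the basis degrees below `a`. A vector of degree at most `a`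
            -- already has degree at most `b`, so new syzygies can appear only at joins of basis
            -- degrees, of which there are finitely many.
            jumps := Finset.univ.image fun S : Finset ι' => S.sup deg'
            le_iSup := ?_ }, d, hmap, fun a => rfl⟩
  intro a ha x hx
  let b := (Finset.univ.filter fun σ : ι' => deg' σ ≤ a).sup deg'
  have hba : b < a := by
    refine lt_of_le_of_ne (Finset.sup_le fun σ hσ => (Finset.mem_filter.1 hσ).2) fun h => ha ?_
    exact Finset.mem_image.2 ⟨_, Finset.mem_univ _, h⟩
  refine Submodule.mem_iSup_of_mem (⟨b, hba⟩ : Set.Iio a) ⟨fun σ hσ => ?_, hx.2⟩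
  exact Finset.le_sup (f := deg') (Finset.mem_filter.2 ⟨Finset.mem_univ _, hx.1 σ hσ⟩)

theorem exists_isMinimal [SemilatticeSup D] [OrderBot D] [WellFoundedLT D] {U : Set D}
    (s : SyzygyFamily K D) (ε : (s.ι → K) →ₗ[K] K)
    (hsurj : ∀ a ∉ U, ∃ v ∈ supportedIn K s.deg (Set.Iic a), ε v = 1)
    (hZ : ∀ a, ∀ v ∈ supportedIn K s.deg (Set.Iic a), (a ∈ U ∨ ε v = 0) ↔ v ∈ s.Z a) :
    ∃ F : StrandResolution K U, F.IsMinimal := by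
  have hseq : ∃ t : ℕ → SyzygyFamily K D, (∀ _ : ℕ, True) ∧ t 0 = s ∧
      ∀ i, ∃ d : ((t (i + 1)).ι → K) →ₗ[K] ((t i).ι → K),
        (∀ a, (supportedIn K (t (i + 1)).deg (Set.Iic a)).map d = (t i).Z a) ∧
        ∀ a, (t (i + 1)).Z a = supportedIn K (t (i + 1)).deg (Set.Iic a) ⊓ LinearMap.ker d :=
    exists_seq_of_step (α := fun _ => SyzygyFamily K D) (P := fun _ _ => True)
      (Q := fun x => x = s)
      (R := fun _ x y => ∃ d : (y.ι → K) →ₗ[K] (x.ι → K),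
        (∀ a, (supportedIn K y.deg (Set.Iic a)).map d = x.Z a) ∧
        ∀ a, y.Z a = supportedIn K y.deg (Set.Iic a) ⊓ LinearMap.ker d)
      ⟨s, trivial, rfl⟩ fun _ x _ => ⟨_, trivial, x.exists_next.choose_spec⟩
  obtain ⟨t, -, rfl, ht⟩ := hseq
  choose d hmap hker using ht
  have hd : ∀ i a, ∀ v ∈ supportedIn K (t (i + 1)).deg (Set.Iic a), d i v ∈ (t i).Z a :=
    fun i a v hv => hmap i a ▸ Submodule.mem_map_of_mem hv
  let F : StrandResolution K U :=
    { ι := fun i => (t i).ι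
      fintype_ι := fun i => inferInstance
      deg := fun i => (t i).deg
      d := d
      ε := ε
      graded := fun i a v hv =>
        supportedIn_mono Set.Iio_subset_Iic_self ((t i).le_lt a (hd i a v hv))
      surjective := hsurj
      exact_zero := fun a v hv => by rw [hZ a v hv, ← hmap 0 a, Submodule.mem_map]
      exact_succ := fun i a v hv => by
        rw [← Submodule.mem_map, hmap, hker, Submodule.mem_inf, LinearMap.mem_ker,
          and_iff_right hv] }
  exact ⟨F, fun i l v hv => (t i).le_lt l (hd i l v hv)⟩

end SyzygyFamily

theorem StrandResolution.exists_isMinimal {K : Type*} [Field K] {D : Type} [SemilatticeSup D]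
    [OrderBot D] [WellFoundedLT D] {U : Set D} (hU : IsUpperSet U) (J : Finset D)
    (hJ : ∀ a ∈ U, a ∉ J → ∃ b < a, b ∈ U) :
    ∃ F : StrandResolution K U, F.IsMinimal := by
  classical
  let s : SyzygyFamily K D :=
    -- One generator of degree `⊥`, or none when the ideal is the whole ring and the minimal
    -- resolution is zero.
    { ι := {u : Unit // ⊥ ∉ U}
      fintype_ι := inferInstance
      deg := fun _ => ⊥
      Z := fun a => if a ∈ U then ⊤ else ⊥
      mono := by
        intro a b hab
        by_cases ha : a ∈ U
        · simp [ha, hU hab ha]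
        · simp [ha]
      le_lt := by
        intro a v hv σ hσ
        by_cases ha : a ∈ U
        · exact bot_lt_iff_ne_bot.2 fun h => σ.2 (h ▸ ha)
        · simp only [ha, if_false, Submodule.mem_bot] at hv
          exact absurd (by simp [hv]) hσ
      jumps := J
      le_iSup := by
        intro a ha
        by_cases haU : a ∈ U
        · obtain ⟨b, hba, hb⟩ := hJ a haU ha
          refine le_trans ?_ (le_iSup (fun b : Set.Iio a => _) (⟨b, hba⟩ : Set.Iio a))
          simp [haU, hb]
        · simp [haU] }
  have hε : ∀ v, (Fintype.linearCombination K (fun _ => 1) : (s.ι → K) →ₗ[K] K) v = ∑ i, v i :=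
    fun v => by simp [Fintype.linearCombination_apply]
  refine s.exists_isMinimal (Fintype.linearCombination K fun _ => 1) (fun a ha => ?_)
    fun a v hv => ?_
  · have h0 : ⊥ ∉ U := fun h => ha (hU bot_le h)
    refine ⟨fun _ => 1, fun _ _ => bot_le, ?_⟩
    rw [hε]
    have : Unique s.ι := ⟨⟨⟨(), h0⟩⟩, fun _ => Subsingleton.elim _ _⟩
    simp
  · change _ ↔ v ∈ (if a ∈ U then ⊤ else ⊥ : Submodule K (s.ι → K))
    by_cases ha : a ∈ U
    · simp only [ha, true_or, if_true]
      exact ⟨fun _ => Submodule.mem_top, fun _ => trivial⟩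
    · have h0 : ⊥ ∉ U := fun h => ha (hU bot_le h)
      have : Unique s.ι := ⟨⟨⟨(), h0⟩⟩, fun _ => Subsingleton.elim _ _⟩
      rw [hε, Fintype.sum_unique, if_neg ha, Submodule.mem_bot, or_iff_right ha]
      exact ⟨fun h => funext fun x => by rw [Subsingleton.elim x default, h]; rfl,
        fun h => by rw [h]; rfl⟩

/-! ### The Taylor complex -/

/-! ### Signed boundary and cone of a simplex. -/

section Faces

variable {K : Type*} [Field K] {α : Type*}

/-- The incidence sign of `σ` in `insert m σ`, for the order of the vertices given by `r`. -/
def faceSign (K : Type*) [Field K] {α : Type*} (r : α → ℕ) (σ : Finset α) (m : α) : K :=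
  (-1) ^ (σ.filter fun g => r g < r m).card

theorem faceSign_mul_self (r : α → ℕ) (σ : Finset α) (m : α) :
    faceSign K r σ m * faceSign K r σ m = 1 := by
  rw [faceSign, ← pow_add, ← two_mul, pow_mul]
  simp

variable [DecidableEq α]

theorem faceSign_insert_of_lt (r : α → ℕ) {σ : Finset α} {m v : α} (hm : m ∉ σ) (h : r m < r v) :
    faceSign K r (insert m σ) v = -faceSign K r σ v := by
  rw [faceSign, faceSign, Finset.filter_insert, if_pos h, Finset.card_insert_of_notMem, pow_succ]
  · ring
  · simp [hm]

theorem faceSign_insert_of_le (r : α → ℕ) {σ : Finset α} {m v : α} (h : r v ≤ r m) :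
    faceSign K r (insert m σ) v = faceSign K r σ v := by
  rw [faceSign, faceSign, Finset.filter_insert, if_neg h.not_gt]

/-- Inserting the smaller of two vertices flips the sign of the larger one, while inserting the
larger does not affect the smaller. This anticommutation gives both `boundary_boundary` and
`boundary_cone`. -/
theorem faceSign_mul {r : α → ℕ} (hr : Function.Injective r) {σ : Finset α} {m v : α}
    (hm : m ∉ σ) (hv : v ∉ σ) (hmv : m ≠ v) :
    faceSign K r σ v * faceSign K r σ m =
      -(faceSign K r (insert v σ) m * faceSign K r (insert m σ) v) := by
  rcases lt_or_gt_of_ne (fun h => hmv (hr h) : r m ≠ r v) with h | h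
  · rw [faceSign_insert_of_lt r hm h, faceSign_insert_of_le r h.le]
    ring
  · rw [faceSign_insert_of_lt r hv h, faceSign_insert_of_le r h.le]
    ring

/-- The boundary map of the simplex with vertex set `G`, including the empty face. -/
def boundary (r : α → ℕ) (G : Finset α) : (Finset α → K) →ₗ[K] (Finset α → K) where
  toFun x σ := ∑ m ∈ G \ σ, faceSign K r σ m * x (insert m σ)
  map_add' x y := by
    ext σ
    simp [mul_add, Finset.sum_add_distrib]
  map_smul' c x := by
    ext σ
    simp [Finset.mul_sum, mul_left_comm]

theorem boundary_apply (r : α → ℕ) (G : Finset α) (x : Finset α → K) (σ : Finset α) :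
    boundary r G x σ = ∑ m ∈ G \ σ, faceSign K r σ m * x (insert m σ) := rfl

/-- The cone with vertex `v`. -/
def cone (r : α → ℕ) (v : α) : (Finset α → K) →ₗ[K] (Finset α → K) where
  toFun x σ := if v ∈ σ then faceSign K r (σ.erase v) v * x (σ.erase v) else 0
  map_add' x y := by
    ext σ
    by_cases h : v ∈ σ <;> simp [h, mul_add]
  map_smul' c x := by
    ext σ
    by_cases h : v ∈ σ <;> simp [h, mul_left_comm]

theorem cone_apply_of_mem (r : α → ℕ) {v : α} (x : Finset α → K) {σ : Finset α} (h : v ∈ σ) :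
    cone r v x σ = faceSign K r (σ.erase v) v * x (σ.erase v) := if_pos h

theorem cone_apply_of_notMem (r : α → ℕ) {v : α} (x : Finset α → K) {σ : Finset α} (h : v ∉ σ) :
    cone r v x σ = 0 := if_neg h

theorem boundary_boundary {r : α → ℕ} (hr : Function.Injective r) (G : Finset α)
    (x : Finset α → K) : boundary r G (boundary r G x) = 0 := by
  ext σ
  simp only [boundary_apply, Finset.mul_sum, Pi.zero_apply]
  rw [Finset.sum_sigma']
  refine Finset.sum_involution (fun p _ => ⟨p.2, p.1⟩) ?_ ?_ ?_ ?_
  · rintro ⟨m, p⟩ h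
    simp only [Finset.mem_sigma, Finset.mem_sdiff, Finset.mem_insert, not_or] at h
    have h1 := faceSign_mul (K := K) hr h.1.2 h.2.2.2 (Ne.symm h.2.2.1)
    have h2 : faceSign K r σ m * faceSign K r (insert m σ) p =
        -(faceSign K r σ p * faceSign K r (insert p σ) m) := by
      have e1 := faceSign_mul_self (K := K) r σ p
      have e2 := faceSign_mul_self (K := K) r (insert p σ) m
      have h3 : faceSign K r σ m = faceSign K r σ p *
          -(faceSign K r (insert p σ) m * faceSign K r (insert m σ) p) := by
        rw [← h1, ← mul_assoc, e1, one_mul]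
      have e3 := faceSign_mul_self (K := K) r (insert m σ) p
      rw [h3]
      linear_combination (-(faceSign K r σ p * faceSign K r (insert p σ) m)) * e3
    rw [Finset.insert_comm p m, ← mul_assoc, ← mul_assoc, h2]
    ring
  · rintro ⟨m, p⟩ h _ heq
    simp only [Finset.mem_sigma, Finset.mem_sdiff, Finset.mem_insert, not_or] at h
    exact h.2.2.1 (congrArg Sigma.fst heq)
  · rintro ⟨m, p⟩ h
    simp only [Finset.mem_sigma, Finset.mem_sdiff, Finset.mem_insert, not_or] at h ⊢
    exact ⟨⟨h.2.1, h.2.2.2⟩, h.1.1, Ne.symm h.2.2.1, h.1.2⟩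
  · rintro ⟨m, p⟩ _
    rfl

/-- The cone is a contracting homotopy; all acyclicity statements about the Taylor complex come from
it. -/
theorem boundary_cone {r : α → ℕ} (hr : Function.Injective r) {G : Finset α} {v : α} (hv : v ∈ G)
    (x : Finset α → K) : boundary r G (cone r v x) + cone r v (boundary r G x) = x := by
  ext σ
  rw [Pi.add_apply, boundary_apply]
  by_cases h : v ∈ σ
  · rw [cone_apply_of_mem r _ h, boundary_apply, Finset.mul_sum]
    have hset : G \ σ.erase v = insert v (G \ σ) := by
      ext m
      by_cases hm : m = v
      · subst hm; simp [hv]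
      · simp [hm]
    rw [hset, Finset.sum_insert (by simp [h]), ← mul_assoc, faceSign_mul_self, one_mul,
      Finset.insert_erase h, add_left_comm, ← Finset.sum_add_distrib, Finset.sum_eq_zero, add_zero]
    intro m hm
    have hmσ : m ∉ σ := (Finset.mem_sdiff.1 hm).2
    have hmv : m ≠ v := fun h' => hmσ (h' ▸ h)
    have h1 := faceSign_mul (K := K) hr (σ := σ.erase v) (m := m) (v := v) (by simp [hmσ])
      (by simp) hmv
    rw [Finset.insert_erase h] at h1
    rw [cone_apply_of_mem r _ (Finset.mem_insert_of_mem h), Finset.erase_insert_of_ne hmv]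
    linear_combination x (insert m (σ.erase v)) * h1
  · rw [cone_apply_of_notMem r _ h, add_zero, Finset.sum_eq_single v]
    · rw [cone_apply_of_mem r _ (Finset.mem_insert_self v σ), Finset.erase_insert h, ← mul_assoc,
        faceSign_mul_self, one_mul]
    · intro m _ hm
      rw [cone_apply_of_notMem, mul_zero]
      simp [hm.symm, h]
    · intro h'
      exact absurd (Finset.mem_sdiff.2 ⟨hv, h⟩) h'

/-- The chains supported on the `k`-element subsets of `G`. -/
abbrev chains (K : Type*) [Field K] {α : Type*} [DecidableEq α] (G : Finset α) (k : ℕ) :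
    Submodule K (Finset α → K) := supportedIn K id (G.powersetCard k : Set (Finset α))

theorem boundary_mem_chains (r : α → ℕ) {G : Finset α} {k : ℕ} {x : Finset α → K}
    (hx : x ∈ chains K G (k + 1)) : boundary r G x ∈ chains K G k := by
  intro σ hσ
  obtain ⟨m, hm, h0⟩ := Finset.exists_ne_zero_of_sum_ne_zero hσ
  have h1 := hx _ (right_ne_zero_of_mul h0)
  simp only [id, Finset.mem_coe, Finset.mem_powersetCard] at h1 ⊢
  rw [Finset.card_insert_of_notMem (Finset.mem_sdiff.1 hm).2] at h1
  exact ⟨(Finset.subset_insert _ _).trans h1.1, by omega⟩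

theorem boundary_eq_zero_of_mem_chains_zero (r : α → ℕ) {G : Finset α} {x : Finset α → K}
    (hx : x ∈ chains K G 0) : boundary r G x = 0 := by
  ext σ
  rw [boundary_apply, Pi.zero_apply]
  refine Finset.sum_eq_zero fun m _ => ?_
  by_contra h0
  have h1 := hx _ (right_ne_zero_of_mul h0)
  simp at h1

theorem cone_mem_chains (r : α → ℕ) {G : Finset α} {v : α} (hv : v ∈ G) {k : ℕ}
    {x : Finset α → K} (hx : x ∈ chains K G k) : cone r v x ∈ chains K G (k + 1) := by
  intro σ hσ
  by_cases h : v ∈ σ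
  · rw [cone_apply_of_mem r _ h] at hσ
    have h1 := hx _ (right_ne_zero_of_mul hσ)
    simp only [id, Finset.mem_coe, Finset.mem_powersetCard] at h1 ⊢
    rw [Finset.card_erase_of_mem h] at h1
    have := Finset.card_pos.2 ⟨v, h⟩
    refine ⟨?_, by omega⟩
    rw [← Finset.insert_erase h]
    exact Finset.insert_subset hv h1.1
  · exact absurd (cone_apply_of_notMem r x h) hσ

end Faces

/-! ### The Taylor resolution and its homology modulo lower degrees. -/

section TaylorComplex

variable {K : Type*} [Field K] {n : ℕ}

theorem taylorMdeg_mono {σ τ : Finset (Fin n →₀ ℕ)} (h : σ ⊆ τ) : taylorMdeg σ ≤ taylorMdeg τ :=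
  Finset.sup_mono h

theorem taylorMdeg_le_iff {σ : Finset (Fin n →₀ ℕ)} {a : Fin n →₀ ℕ} :
    taylorMdeg σ ≤ a ↔ ∀ g ∈ σ, g ≤ a := Finset.sup_le_iff

theorem taylorMdeg_insert (v : Fin n →₀ ℕ) (σ : Finset (Fin n →₀ ℕ)) :
    taylorMdeg (insert v σ) = v ⊔ taylorMdeg σ := Finset.sup_insert

theorem boundary_mem_supportedIn (r : (Fin n →₀ ℕ) → ℕ) (G : Finset (Fin n →₀ ℕ))
    {s : Set (Fin n →₀ ℕ)} (hs : IsLowerSet s) {x : Finset (Fin n →₀ ℕ) → K}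
    (hx : x ∈ supportedIn K taylorMdeg s) : boundary r G x ∈ supportedIn K taylorMdeg s := by
  intro σ hσ
  obtain ⟨m, _, h0⟩ := Finset.exists_ne_zero_of_sum_ne_zero hσ
  exact hs (taylorMdeg_mono (Finset.subset_insert m σ)) (hx _ (right_ne_zero_of_mul h0))

theorem cone_mem_supportedIn (r : (Fin n →₀ ℕ) → ℕ) {v a : Fin n →₀ ℕ} (hv : v ≤ a)
    {x : Finset (Fin n →₀ ℕ) → K} (hx : x ∈ supportedIn K taylorMdeg (Set.Iic a)) :
    cone r v x ∈ supportedIn K taylorMdeg (Set.Iic a) := by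
  intro σ hσ
  by_cases h : v ∈ σ
  · rw [cone_apply_of_mem r _ h] at hσ
    have h1 : taylorMdeg (σ.erase v) ≤ a := hx _ (right_ne_zero_of_mul hσ)
    rw [← Finset.insert_erase h, taylorMdeg_insert]
    exact sup_le hv h1
  · exact absurd (cone_apply_of_notMem r x h) hσ

/-- Chains in coordinates, as functions on all finite sets. -/
noncomputable def extendChain (K : Type*) [Field K] {n : ℕ} (G : Finset (Fin n →₀ ℕ)) (k : ℕ) :
    ({σ // σ ∈ G.powersetCard k} → K) →ₗ[K] (Finset (Fin n →₀ ℕ) → K) :=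
  Function.ExtendByZero.linearMap K Subtype.val

variable {G : Finset (Fin n →₀ ℕ)} {k : ℕ}

theorem extendChain_apply (x : {σ // σ ∈ G.powersetCard k} → K)
    (σ : {σ // σ ∈ G.powersetCard k}) : extendChain K G k x σ = x σ :=
  Function.Injective.extend_apply Subtype.val_injective _ _ _

theorem extendChain_apply_of_notMem (x : {σ // σ ∈ G.powersetCard k} → K)
    {σ : Finset (Fin n →₀ ℕ)} (h : σ ∉ G.powersetCard k) : extendChain K G k x σ = 0 :=
  Function.extend_apply' _ _ _ (by rintro ⟨⟨τ, hτ⟩, rfl⟩; exact h hτ)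

theorem extendChain_mem_chains (x : {σ // σ ∈ G.powersetCard k} → K) :
    extendChain K G k x ∈ chains K G k := by
  intro σ hσ
  by_contra h
  exact hσ (extendChain_apply_of_notMem x h)

/-- The coordinates of a chain. -/
def restrictChain (K : Type*) [Field K] {n : ℕ} (G : Finset (Fin n →₀ ℕ)) (k : ℕ) :
    (Finset (Fin n →₀ ℕ) → K) →ₗ[K] ({σ // σ ∈ G.powersetCard k} → K) :=
  LinearMap.funLeft K K Subtype.val

theorem restrictChain_extendChain (x : {σ // σ ∈ G.powersetCard k} → K) :
    restrictChain K G k (extendChain K G k x) = x :=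
  funext fun σ => extendChain_apply x σ

theorem extendChain_restrictChain {x : Finset (Fin n →₀ ℕ) → K} (hx : x ∈ chains K G k) :
    extendChain K G k (restrictChain K G k x) = x := by
  ext σ
  by_cases h : σ ∈ G.powersetCard k
  · exact extendChain_apply _ ⟨σ, h⟩
  · rw [extendChain_apply_of_notMem _ h]
    by_contra h0
    exact h (hx σ (Ne.symm h0))

theorem extendChain_mem_supportedIn {s : Set (Fin n →₀ ℕ)}
    {x : {σ // σ ∈ G.powersetCard k} → K} :
    extendChain K G k x ∈ supportedIn K taylorMdeg s ↔
      x ∈ supportedIn K (fun σ => taylorMdeg σ.1) s := by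
  constructor
  · intro h σ hσ
    exact h σ.1 (by rwa [extendChain_apply])
  · intro h σ hσ
    have hm : σ ∈ G.powersetCard k := extendChain_mem_chains x σ hσ
    exact h ⟨σ, hm⟩ (by rwa [← extendChain_apply x ⟨σ, hm⟩])

theorem restrictChain_mem_supportedIn {s : Set (Fin n →₀ ℕ)} {x : Finset (Fin n →₀ ℕ) → K}
    (hx : x ∈ supportedIn K taylorMdeg s) :
    restrictChain K G k x ∈ supportedIn K (fun σ => taylorMdeg σ.1) s := fun σ hσ => hx σ.1 hσ

/-- The differential of the Taylor complex. -/
noncomputable def taylorD (K : Type*) [Field K] {n : ℕ} (r : (Fin n →₀ ℕ) → ℕ)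
    (G : Finset (Fin n →₀ ℕ)) (k : ℕ) :
    ({σ // σ ∈ G.powersetCard (k + 1)} → K) →ₗ[K] ({σ // σ ∈ G.powersetCard k} → K) :=
  restrictChain K G k ∘ₗ boundary r G ∘ₗ extendChain K G (k + 1)

theorem extendChain_taylorD (r : (Fin n →₀ ℕ) → ℕ) (x : {σ // σ ∈ G.powersetCard (k + 1)} → K) :
    extendChain K G k (taylorD K r G k x) = boundary r G (extendChain K G (k + 1) x) :=
  extendChain_restrictChain (boundary_mem_chains r (extendChain_mem_chains x))

/-- The cone over a generator `v ≤ a` stays in degrees at most `a`. If there is no such generator,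
only the empty face has degree at most `a`. -/
theorem exists_boundary_eq {r : (Fin n →₀ ℕ) → ℕ} (hr : Function.Injective r)
    {a : Fin n →₀ ℕ} {x : Finset (Fin n →₀ ℕ) → K} (hx : x ∈ chains K G k)
    (hxa : x ∈ supportedIn K taylorMdeg (Set.Iic a)) (h0 : boundary r G x = 0)
    (ha : (∃ g ∈ G, g ≤ a) ∨ x ∅ = 0) :
    ∃ w ∈ chains K G (k + 1), w ∈ supportedIn K taylorMdeg (Set.Iic a) ∧ boundary r G w = x := by
  by_cases hg : ∃ g ∈ G, g ≤ a
  · obtain ⟨v, hv, hva⟩ := hg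
    refine ⟨cone r v x, cone_mem_chains r hv hx, cone_mem_supportedIn r hva hxa, ?_⟩
    have := boundary_cone (K := K) hr hv x
    rwa [h0, map_zero, add_zero] at this
  · refine ⟨0, Submodule.zero_mem _, Submodule.zero_mem _, ?_⟩
    rw [map_zero, eq_comm]
    ext σ
    by_contra hσ
    have h1 := hx σ hσ
    simp only [id, Finset.mem_coe, Finset.mem_powersetCard] at h1
    rcases σ.eq_empty_or_nonempty with rfl | ⟨g, hgσ⟩
    · exact hσ (ha.resolve_left hg)
    · exact hg ⟨g, h1.1 hgσ, taylorMdeg_le_iff.1 (hxa σ hσ) g hgσ⟩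

theorem exists_taylorD_eq {r : (Fin n →₀ ℕ) → ℕ} (hr : Function.Injective r)
    {a : Fin n →₀ ℕ} {x : {σ // σ ∈ G.powersetCard k} → K}
    (hxa : x ∈ supportedIn K (fun σ => taylorMdeg σ.1) (Set.Iic a))
    (h0 : boundary r G (extendChain K G k x) = 0)
    (ha : (∃ g ∈ G, g ≤ a) ∨ extendChain K G k x ∅ = 0) :
    ∃ w ∈ supportedIn K (fun σ => taylorMdeg σ.1) (Set.Iic a), taylorD K r G k w = x := by
  obtain ⟨w, hw, hwa, hwx⟩ := exists_boundary_eq hr (extendChain_mem_chains x)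
    (extendChain_mem_supportedIn.2 hxa) h0 ha
  refine ⟨restrictChain K G (k + 1) w, restrictChain_mem_supportedIn hwa, ?_⟩
  rw [taylorD, LinearMap.comp_apply, LinearMap.comp_apply, extendChain_restrictChain hw, hwx,
    restrictChain_extendChain]

/-- The Taylor resolution. -/
noncomputable def taylorResolution (K : Type*) [Field K] {n : ℕ} {r : (Fin n →₀ ℕ) → ℕ}
    (hr : Function.Injective r) (G : Finset (Fin n →₀ ℕ)) :
    StrandResolution K {a : Fin n →₀ ℕ | ∃ g ∈ G, g ≤ a} where
  ι k := {σ // σ ∈ G.powersetCard k}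
  fintype_ι k := inferInstance
  deg k σ := taylorMdeg σ.1
  d k := taylorD K r G k
  ε := LinearMap.proj ∅ ∘ₗ extendChain K G 0
  graded k a x hx := restrictChain_mem_supportedIn
    (boundary_mem_supportedIn r G (isLowerSet_Iic a) (extendChain_mem_supportedIn.2 hx))
  surjective a _ := by
    have h0 : ∅ ∈ G.powersetCard 0 := by simp
    refine ⟨fun _ => 1, ?_, extendChain_apply (fun _ => 1) ⟨∅, h0⟩⟩
    rintro ⟨σ, hσ⟩ -
    have : σ = ∅ := by simpa using hσ
    subst this
    exact taylorMdeg_le_iff.2 (by simp)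
  exact_zero a x hx := by
    constructor
    · exact exists_taylorD_eq hr hx
        (boundary_eq_zero_of_mem_chains_zero r (extendChain_mem_chains x))
    · rintro ⟨w, hw, rfl⟩
      by_cases ha : ∃ g ∈ G, g ≤ a
      · exact Or.inl ha
      · right
        have : w = 0 := by
          ext ⟨σ, hσ⟩
          by_contra h
          have h1 := hw _ h
          rw [Finset.mem_powersetCard] at hσ
          obtain ⟨g, hg⟩ := Finset.card_pos.1 (hσ.2 ▸ Nat.one_pos)
          exact ha ⟨g, hσ.1 hg, taylorMdeg_le_iff.1 h1 g hg⟩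
        rw [this, map_zero, map_zero]
  exact_succ k a x hx := by
    constructor
    · intro h
      refine exists_taylorD_eq hr hx ?_ (Or.inr ?_)
      · rw [← extendChain_taylorD, h, map_zero]
      · exact extendChain_apply_of_notMem _ (by simp)
    · rintro ⟨w, hw, rfl⟩
      rw [← restrictChain_extendChain (taylorD K r G k _), extendChain_taylorD,
        extendChain_taylorD, boundary_boundary hr, map_zero]

/-- Moves the computation to functions on all finite sets, where the boundary and the cone are
defined without dependent index types. -/
theorem taylorResolution_relHomologyDim {r : (Fin n →₀ ℕ) → ℕ} (hr : Function.Injective r)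
    {l : Fin n →₀ ℕ} {b : ℕ} (f : (Finset (Fin n →₀ ℕ) → K) →ₗ[K] (Fin b → K))
    (h1 : ∀ x ∈ supportedIn K taylorMdeg (Set.Iio l), f x = 0)
    (h2 : ∀ x ∈ supportedIn K taylorMdeg (Set.Iic l), f (boundary r G x) = 0)
    (h3 : ∀ x ∈ chains K G k, x ∈ supportedIn K taylorMdeg (Set.Iic l) →
      boundary r G x ∈ supportedIn K taylorMdeg (Set.Iio l) → f x = 0 →
      ∃ w ∈ chains K G (k + 1), w ∈ supportedIn K taylorMdeg (Set.Iic l) ∧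
        x - boundary r G w ∈ supportedIn K taylorMdeg (Set.Iio l))
    (h4 : ∀ c, ∃ x ∈ chains K G k, x ∈ supportedIn K taylorMdeg (Set.Iic l) ∧
      boundary r G x ∈ supportedIn K taylorMdeg (Set.Iio l) ∧ f x = c) :
    (taylorResolution K hr G).RelHomologyDim k l b := by
  have hrel : ∀ x : {σ // σ ∈ G.powersetCard k} → K, (taylorResolution K hr G).IsRelCycle l k x ↔
      boundary r G (extendChain K G k x) ∈ supportedIn K taylorMdeg (Set.Iio l) := by
    cases k with
    | zero =>
      intro x
      rw [boundary_eq_zero_of_mem_chains_zero r (extendChain_mem_chains x)]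
      exact iff_of_true trivial (Submodule.zero_mem _)
    | succ k =>
      intro x
      rw [← extendChain_taylorD]
      exact extendChain_mem_supportedIn.symm
  refine ⟨f ∘ₗ extendChain K G k, fun x hx => h1 _ (extendChain_mem_supportedIn.2 hx),
    fun x hx => ?_, fun (x : {σ // σ ∈ G.powersetCard k} → K) hx hc h0 => ?_, fun c => ?_⟩
  · exact (congrArg f (extendChain_taylorD r x)).trans (h2 _ (extendChain_mem_supportedIn.2 hx))
  · obtain ⟨w, hw, hwl, hxw⟩ := h3 _ (extendChain_mem_chains x)
      (extendChain_mem_supportedIn.2 hx) ((hrel x).1 hc) h0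
    refine ⟨restrictChain K G (k + 1) w, restrictChain_mem_supportedIn hwl,
      extendChain_mem_supportedIn.1 ?_⟩
    have heq : extendChain K G k (x - taylorD K r G k (restrictChain K G (k + 1) w)) =
        extendChain K G k x - boundary r G w := by
      rw [map_sub, extendChain_taylorD, extendChain_restrictChain hw]
    exact heq ▸ hxw
  · obtain ⟨x, hx, hxl, hxc, hfx⟩ := h4 c
    refine ⟨restrictChain K G k x, restrictChain_mem_supportedIn hxl, (hrel _).2 ?_, ?_⟩
    · rwa [extendChain_restrictChain hx]
    · exact (congrArg f (extendChain_restrictChain hx)).trans hfx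

theorem relHomologyDim_zero_of_forall_ne {r : (Fin n →₀ ℕ) → ℕ} (hr : Function.Injective r)
    {l : Fin n →₀ ℕ} (h : ∀ σ ⊆ G, σ.card = k → taylorMdeg σ ≠ l) :
    (taylorResolution K hr G).RelHomologyDim k l 0 := by
  refine taylorResolution_relHomologyDim hr 0 (fun _ _ => rfl) (fun _ _ => rfl) ?_ fun c =>
    ⟨0, Submodule.zero_mem _, Submodule.zero_mem _, by rw [map_zero]; exact Submodule.zero_mem _,
      Subsingleton.elim _ _⟩
  intro x hx hxl _ _
  refine ⟨0, Submodule.zero_mem _, Submodule.zero_mem _, fun σ hσ => ?_⟩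
  rw [map_zero, sub_zero] at hσ
  have h1 := Finset.mem_powersetCard.1 (hx σ hσ)
  exact lt_of_le_of_ne (Set.mem_Iic.1 (hxl σ hσ)) (h σ h1.1 h1.2)

/-- The witness is the cone of `x`: then `x - ∂ (cone x) = cone (∂ x)`, whose coefficient at `σ ∋ v`
is, up to sign, that of `∂ x` at `σ.erase v`. Since `∂ x` has only degrees below `l`, the last
hypothesis excludes every `σ` of multidegree `l`. -/
theorem exists_sub_boundary_mem {r : (Fin n →₀ ℕ) → ℕ} (hr : Function.Injective r)
    {l v : Fin n →₀ ℕ} (hv : v ∈ G) (hvl : v ≤ l) {x : Finset (Fin n →₀ ℕ) → K}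
    (hx : x ∈ chains K G k) (hxl : x ∈ supportedIn K taylorMdeg (Set.Iic l))
    (hxc : boundary r G x ∈ supportedIn K taylorMdeg (Set.Iio l))
    (h : ∀ σ ⊆ G, v ∈ σ → σ.card = k → taylorMdeg σ = l →
      taylorMdeg (σ.erase v) = l ∨ boundary r G x (σ.erase v) = 0) :
    ∃ w ∈ chains K G (k + 1), w ∈ supportedIn K taylorMdeg (Set.Iic l) ∧
      x - boundary r G w ∈ supportedIn K taylorMdeg (Set.Iio l) := by
  have hw := cone_mem_chains r hv hx
  refine ⟨cone r v x, hw, cone_mem_supportedIn r hvl hxl, fun σ hσ => ?_⟩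
  have hG := Finset.mem_powersetCard.1
    (Submodule.sub_mem _ hx (boundary_mem_chains r hw) σ hσ)
  rw [sub_eq_iff_eq_add'.2 (boundary_cone (K := K) hr hv x).symm] at hσ
  by_cases hvσ : v ∈ σ
  · rw [cone_apply_of_mem r _ hvσ] at hσ
    have hne := right_ne_zero_of_mul hσ
    have hlt : taylorMdeg (σ.erase v) < l := hxc _ hne
    refine Set.mem_Iio.2 (lt_of_le_of_ne (b := l) ?_ fun heq => ?_)
    · rw [← Finset.insert_erase hvσ, taylorMdeg_insert]
      exact sup_le hvl hlt.le
    · exact (h σ hG.1 hvσ hG.2 heq).elim hlt.ne hne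
  · exact absurd (cone_apply_of_notMem r _ hvσ) hσ

theorem relHomologyDim_zero_of_erase {r : (Fin n →₀ ℕ) → ℕ} (hr : Function.Injective r)
    {l v : Fin n →₀ ℕ} (hv : v ∈ G) (hvl : v ≤ l)
    (h : ∀ σ ⊆ G, v ∈ σ → σ.card = k → taylorMdeg σ = l → taylorMdeg (σ.erase v) = l) :
    (taylorResolution K hr G).RelHomologyDim k l 0 :=
  taylorResolution_relHomologyDim hr 0 (fun _ _ => rfl) (fun _ _ => rfl)
    (fun _ hx hxl hxc _ => exists_sub_boundary_mem hr hv hvl hx hxl hxc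
      fun σ hσ hvσ hk hl => Or.inl (h σ hσ hvσ hk hl))
    fun c => ⟨0, Submodule.zero_mem _, Submodule.zero_mem _,
      by rw [map_zero]; exact Submodule.zero_mem _, Subsingleton.elim _ _⟩

theorem boundary_single_ne_zero {r : (Fin n →₀ ℕ) → ℕ} {σ τ : Finset (Fin n →₀ ℕ)} {c : K}
    (h : boundary r G (Pi.single τ c) σ ≠ 0) : ∃ m ∉ σ, insert m σ = τ := by
  obtain ⟨m, hm, h0⟩ := Finset.exists_ne_zero_of_sum_ne_zero h
  refine ⟨m, (Finset.mem_sdiff.1 hm).2, ?_⟩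
  by_contra hne
  exact h0 (by simp [hne])

/-- The class is read off as the coefficient at `σ₀`. Boundaries in degree at most `l` cannot reach
it, because every generator dividing `l` is already in `σ₀`. -/
theorem relHomologyDim_one_of_unique {r : (Fin n →₀ ℕ) → ℕ} (hr : Function.Injective r)
    {l : Fin n →₀ ℕ} {σ₀ : Finset (Fin n →₀ ℕ)} (hσ₀ : σ₀ ⊆ G) (hl : taylorMdeg σ₀ = l)
    (hmem : ∀ g ∈ G, g ≤ l → g ∈ σ₀) (huniq : ∀ σ ⊆ G, taylorMdeg σ = l → σ = σ₀) :
    (taylorResolution K hr G).RelHomologyDim σ₀.card l 1 := by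
  refine taylorResolution_relHomologyDim hr (LinearMap.pi fun _ => LinearMap.proj σ₀) ?_ ?_ ?_ ?_
  · intro x hx
    ext
    by_contra h
    exact (hx σ₀ h).ne hl
  · intro x hx
    ext
    by_contra h
    obtain ⟨m, hm, h0⟩ := Finset.exists_ne_zero_of_sum_ne_zero h
    rw [Finset.mem_sdiff] at hm
    have h1 := hx _ (right_ne_zero_of_mul h0)
    exact hm.2 (hmem m hm.1 (taylorMdeg_le_iff.1 h1 m (Finset.mem_insert_self _ _)))
  · intro x hx hxl _ h0
    refine ⟨0, Submodule.zero_mem _, Submodule.zero_mem _, fun σ hσ => ?_⟩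
    rw [map_zero, sub_zero] at hσ
    refine lt_of_le_of_ne (Set.mem_Iic.1 (hxl σ hσ)) fun heq => hσ ?_
    rw [huniq σ (Finset.mem_powersetCard.1 (hx σ hσ)).1 heq]
    exact congrFun h0 0
  · intro c
    refine ⟨Pi.single σ₀ (c 0), single_mem_supportedIn (by simp [hσ₀]) _,
      single_mem_supportedIn hl.le _, fun σ hσ => ?_, ?_⟩
    · obtain ⟨m, hm, rfl⟩ := boundary_single_ne_zero hσ
      refine lt_of_le_of_ne ((taylorMdeg_mono (Finset.subset_insert m σ)).trans hl.le) fun heq => ?_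
      have := huniq σ ((Finset.subset_insert m σ).trans hσ₀) heq
      exact hm (this ▸ Finset.mem_insert_self m σ)
    · ext j
      rw [Subsingleton.elim j 0]
      simp

/-- The multidegree `l` is that of the sets `A ∪ B'` with `∅ ≠ B' ⊆ B`, where `v` lies in `B`. -/
structure IsPuncturedInterval (G : Finset (Fin n →₀ ℕ)) (l : Fin n →₀ ℕ)
    (A : Finset (Fin n →₀ ℕ)) (v : Fin n →₀ ℕ) : Prop where
  notMem : v ∉ A
  insert_subset : insert v A ⊆ G
  mdeg_ne : taylorMdeg A ≠ l
  mdeg_insert : ∀ m ∈ G, m ≤ l → m ∉ A → taylorMdeg (insert m A) = l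
  le : v ≤ l
  subset : ∀ σ ⊆ G, taylorMdeg σ = l → A ⊆ σ
  erase : ∀ σ ⊆ G, taylorMdeg σ = l → σ.erase v = A ∨ taylorMdeg (σ.erase v) = l

/-- The invariant is the coefficient of `∂ x` at the missing bottom `A`. It vanishes on boundaries
by `∂ ∂ = 0`; when it is zero, nothing obstructs the cone over `v`; and `insert v A` is a relative
cycle on which it is nonzero. -/
theorem IsPuncturedInterval.relHomologyDim_one {r : (Fin n →₀ ℕ) → ℕ} (hr : Function.Injective r)
    {l v : Fin n →₀ ℕ} {A : Finset (Fin n →₀ ℕ)} (h : IsPuncturedInterval G l A v) :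
    (taylorResolution K hr G).RelHomologyDim (A.card + 1) l 1 := by
  have hvG : v ∈ G := h.insert_subset (Finset.mem_insert_self _ _)
  have hvA := h.mdeg_insert v hvG h.le h.notMem
  refine taylorResolution_relHomologyDim hr
    (LinearMap.pi fun _ => LinearMap.proj A ∘ₗ boundary r G) ?_ ?_ ?_ ?_
  · intro x hx
    ext
    by_contra h'
    obtain ⟨m, hm, h0⟩ := Finset.exists_ne_zero_of_sum_ne_zero h'
    rw [Finset.mem_sdiff] at hm
    have h1 : taylorMdeg (insert m A) < l := hx _ (right_ne_zero_of_mul h0)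
    exact h1.ne (h.mdeg_insert m hm.1 (taylorMdeg_le_iff.1 h1.le m (Finset.mem_insert_self _ _))
      hm.2)
  · intro x hx
    ext
    simp [boundary_boundary hr]
  · intro x hx hxl hxc h0
    refine exists_sub_boundary_mem hr hvG h.le hx hxl hxc fun σ hσ _ _ hl => ?_
    refine (h.erase σ hσ hl).symm.imp_right fun heq => ?_
    rw [heq]
    exact congrFun h0 0
  · intro c
    refine ⟨Pi.single (insert v A) (faceSign K r A v * c 0), single_mem_supportedIn ?_ _,
      single_mem_supportedIn hvA.le _, fun σ hσ => ?_, ?_⟩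
    · simp only [id, Finset.mem_coe, Finset.mem_powersetCard]
      exact ⟨h.insert_subset, Finset.card_insert_of_notMem h.notMem⟩
    · obtain ⟨m, hm, heq⟩ := boundary_single_ne_zero hσ
      have hsub : σ ⊆ insert v A := heq ▸ Finset.subset_insert m σ
      refine lt_of_le_of_ne ((taylorMdeg_mono hsub).trans hvA.le) fun hl => ?_
      have hA := h.subset σ (hsub.trans h.insert_subset) hl
      have hcard := congrArg Finset.card heq
      rw [Finset.card_insert_of_notMem hm, Finset.card_insert_of_notMem h.notMem] at hcard
      have : A = σ := Finset.eq_of_subset_of_card_le hA (by omega)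
      exact h.mdeg_ne (this ▸ hl)
    · ext j
      rw [Subsingleton.elim j 0]
      simp only [LinearMap.pi_apply, LinearMap.comp_apply, LinearMap.proj_apply, boundary_apply]
      rw [Finset.sum_eq_single v]
      · rw [Pi.single_eq_same, ← mul_assoc, faceSign_mul_self, one_mul]
      · intro m hm hmv
        rw [Pi.single_eq_of_ne, mul_zero]
        intro heq
        have := heq ▸ Finset.mem_insert_self m A
        exact (Finset.mem_insert.1 this).elim hmv (Finset.mem_sdiff.1 hm).2
      · intro hv
        exact absurd (Finset.mem_sdiff.2 ⟨hvG, h.notMem⟩) hv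

theorem IsPuncturedInterval.relHomologyDim_zero {r : (Fin n →₀ ℕ) → ℕ} (hr : Function.Injective r)
    {l v : Fin n →₀ ℕ} {A : Finset (Fin n →₀ ℕ)} (h : IsPuncturedInterval G l A v)
    (hk : k ≠ A.card + 1) : (taylorResolution K hr G).RelHomologyDim k l 0 := by
  refine relHomologyDim_zero_of_erase hr (h.insert_subset (Finset.mem_insert_self _ _)) h.le
    fun σ hσ hv hσk hl => (h.erase σ hσ hl).resolve_left fun heq => hk ?_
  rw [← heq, Finset.card_erase_of_mem hv, hσk]
  have := Finset.card_pos.2 ⟨v, hv⟩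
  omega

end TaylorComplex

/-! ### Almost generic sets of monomials -/

section AlmostGeneric

variable {n : ℕ}

/-- Exponents equal to zero are attained by no element when `σ` is empty, hence the restriction to
`l j ≠ 0`. -/
theorem taylorMdeg_eq_iff {σ : Finset (Fin n →₀ ℕ)} {l : Fin n →₀ ℕ} :
    taylorMdeg σ = l ↔ (∀ g ∈ σ, g ≤ l) ∧ ∀ j, l j ≠ 0 → ∃ g ∈ σ, g j = l j := by
  constructor
  · rintro rfl
    refine ⟨fun g hg => Finset.le_sup (f := id) hg, fun j hj => ?_⟩
    have hcoord : taylorMdeg σ j = σ.sup fun g => g j := by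
      classical
      rw [taylorMdeg]
      induction σ using Finset.induction_on with
      | empty => rfl
      | insert a s _ ih =>
        rw [Finset.sup_insert, Finset.sup_insert, Finsupp.sup_apply]
        -- The induction hypothesis carries the assumption that the coordinate is nonzero, so the
        -- zero case is separate.
        by_cases h : s.sup id j = 0
        · have : (s.sup fun g => g j) = 0 := by
            rw [← Nat.bot_eq_zero, Finset.sup_eq_bot_iff]
            intro g hg
            have : g ≤ s.sup id := Finset.le_sup (f := id) hg
            exact Nat.le_zero.1 (h ▸ this j)
          rw [h, this]
          rfl
        · exact congrArg (a j ⊔ ·) (ih h)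
    have hne : σ.Nonempty := by
      rw [Finset.nonempty_iff_ne_empty]
      rintro rfl
      exact hj rfl
    obtain ⟨g, hg, h⟩ := Finset.exists_mem_eq_sup σ hne fun g => g j
    exact ⟨g, hg, by rw [hcoord, h]⟩
  · rintro ⟨h1, h2⟩
    refine le_antisymm (taylorMdeg_le_iff.2 h1) fun j => ?_
    by_cases hj : l j = 0
    · exact hj ▸ Nat.zero_le _
    · obtain ⟨g, hg, h⟩ := h2 j hj
      have : g ≤ taylorMdeg σ := Finset.le_sup (f := id) hg
      exact h ▸ this j

theorem multidegree_cases_of_almostGeneric {G : Finset (Fin n →₀ ℕ)} {i : Fin n}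
    (hG : ∀ j ≠ i, ∀ a ∈ G, ∀ b ∈ G, a ≠ b → a j = b j → a j = 0) (l : Fin n →₀ ℕ) :
    (∀ σ ⊆ G, taylorMdeg σ ≠ l) ∨
    (∃ v ∈ G, v ≤ l ∧ ∀ σ ⊆ G, taylorMdeg σ = l → taylorMdeg (σ.erase v) = l) ∨
    (∃ σ₀ ⊆ G, taylorMdeg σ₀ = l ∧ (∀ g ∈ G, g ≤ l → g ∈ σ₀) ∧
      ∀ σ ⊆ G, taylorMdeg σ = l → σ = σ₀) ∨
    ∃ A v, IsPuncturedInterval G l A v := by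
  classical
  by_cases hex : ∃ τ ⊆ G, taylorMdeg τ = l
  swap
  · exact Or.inl fun σ hσ hl => hex ⟨σ, hσ, hl⟩
  right
  obtain ⟨τ, hτG, hτ⟩ := hex
  let A := G.filter fun g => g ≤ l ∧ ∃ j, j ≠ i ∧ l j ≠ 0 ∧ g j = l j
  have hAG : A ⊆ G := Finset.filter_subset _ _
  have hAl : ∀ g ∈ A, g ≤ l := fun g hg => (Finset.mem_filter.1 hg).2.1
  have hle : ∀ σ, taylorMdeg σ = l → ∀ g ∈ σ, g ≤ l := fun σ hl => (taylorMdeg_eq_iff.1 hl).1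
  have hA : ∀ σ ⊆ G, taylorMdeg σ = l → A ⊆ σ := by
    intro σ hσ hl g hg
    obtain ⟨hgG, -, j, hji, hj0, hj⟩ := Finset.mem_filter.1 hg
    obtain ⟨h, hhσ, hh⟩ := (taylorMdeg_eq_iff.1 hl).2 j hj0
    by_contra hgσ
    refine hj0 (hj ▸ hG j hji g hgG h (hσ hhσ) ?_ (hj.trans hh.symm))
    rintro rfl
    exact hgσ hhσ
  have hmem : ∀ j, j ≠ i → l j ≠ 0 → ∃ g ∈ A, g j = l j := by
    intro j hji hj
    obtain ⟨g, hg, hgj⟩ := (taylorMdeg_eq_iff.1 hτ).2 j hj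
    exact ⟨g, Finset.mem_filter.2 ⟨hτG hg, hle τ hτ g hg, j, hji, hj, hgj⟩, hgj⟩
  have hmdeg : ∀ σ, A ⊆ σ → (∀ g ∈ σ, g ≤ l) → (l i ≠ 0 → ∃ g ∈ σ, g i = l i) →
      taylorMdeg σ = l := by
    intro σ hAσ hσl hi
    refine taylorMdeg_eq_iff.2 ⟨hσl, fun j hj => ?_⟩
    by_cases hji : j = i
    · exact hji ▸ hi (hji ▸ hj)
    · obtain ⟨g, hg, h⟩ := hmem j hji hj
      exact ⟨g, hAσ hg, h⟩
  -- If `A` also takes care of `i`, the sets of multidegree `l` form the whole interval from `A` to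
  -- all generators dividing `l`: a single set, or one in which any `v ∉ A` is free.
  by_cases hAi : l i ≠ 0 → ∃ g ∈ A, g i = l i
  · by_cases hall : ∀ g ∈ G, g ≤ l → g ∈ A
    · refine Or.inr (Or.inl ⟨A, hAG, hmdeg A subset_rfl hAl hAi, hall, fun σ hσ hl => ?_⟩)
      exact (hA σ hσ hl).antisymm' fun g hg => hall g (hσ hg) (hle σ hl g hg)
    · push Not at hall
      obtain ⟨v, hvG, hvl, hvA⟩ := hall
      refine Or.inl ⟨v, hvG, hvl, fun σ hσ hl => ?_⟩
      have hsub : A ⊆ σ.erase v := Finset.subset_erase.2 ⟨hA σ hσ hl, hvA⟩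
      refine hmdeg _ hsub (fun g hg => hle σ hl g (Finset.mem_of_mem_erase hg)) fun hi => ?_
      obtain ⟨g, hg, h⟩ := hAi hi
      exact ⟨g, hsub hg, h⟩
  · push Not at hAi
    obtain ⟨hi, hAi⟩ := hAi
    by_cases hall : ∀ g ∈ G, g ≤ l → g ∉ A → g i = l i
    · obtain ⟨v, hvτ, hvi⟩ := (taylorMdeg_eq_iff.1 hτ).2 i hi
      have hvA : v ∉ A := fun h => hAi v h hvi
      have hvl := hle τ hτ v hvτ
      refine Or.inr (Or.inr ⟨A, v, hvA, Finset.insert_subset (hτG hvτ) hAG, fun h => ?_,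
        fun m hm hml hmA => ?_, hvl, hA, fun σ hσ hl => ?_⟩)
      · obtain ⟨g, hg, hgi⟩ := (taylorMdeg_eq_iff.1 h).2 i hi
        exact hAi g hg hgi
      · refine hmdeg _ (Finset.subset_insert _ _) ?_
          fun _ => ⟨m, Finset.mem_insert_self _ _, hall m hm hml hmA⟩
        intro g hg
        rcases Finset.mem_insert.1 hg with rfl | hg
        · exact hml
        · exact hAl g hg
      · have hsub : A ⊆ σ.erase v := Finset.subset_erase.2 ⟨hA σ hσ hl, hvA⟩
        by_cases heq : σ.erase v ⊆ A
        · exact Or.inl (heq.antisymm hsub)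
        · right
          obtain ⟨g, hg, hgA⟩ := Finset.not_subset.1 heq
          have hgσ := Finset.mem_of_mem_erase hg
          exact hmdeg _ hsub (fun g hg => hle σ hl g (Finset.mem_of_mem_erase hg)) fun _ =>
            ⟨g, hg, hall g (hσ hgσ) (hle σ hl g hgσ) hgA⟩
    · push Not at hall
      -- Such a `v` plays no role for any exponent of `l`: it is outside `A` and misses `l i`, so it
      -- can be erased freely.
      obtain ⟨v, hvG, hvl, hvA, hvi⟩ := hall
      refine Or.inl ⟨v, hvG, hvl, fun σ hσ hl => ?_⟩
      have hsub : A ⊆ σ.erase v := Finset.subset_erase.2 ⟨hA σ hσ hl, hvA⟩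
      refine hmdeg _ hsub (fun g hg => hle σ hl g (Finset.mem_of_mem_erase hg)) fun _ => ?_
      obtain ⟨g, hg, h⟩ := (taylorMdeg_eq_iff.1 hl).2 i hi
      exact ⟨g, Finset.mem_erase.2 ⟨fun h' => hvi (h' ▸ h), hg⟩, h⟩

theorem even_card_of_toggle {α : Type*} [DecidableEq α] {Y : Finset (Finset α)} {v : α}
    (h1 : ∀ σ ∈ Y, v ∈ σ → σ.erase v ∈ Y) (h2 : ∀ σ ∈ Y, v ∉ σ → insert v σ ∈ Y) :
    Even Y.card := by
  rw [← Finset.card_filter_add_card_filter_not (s := Y) fun σ => v ∈ σ]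
  have : (Y.filter fun σ => v ∈ σ).card = (Y.filter fun σ => v ∉ σ).card := by
    refine Finset.card_bij' (fun σ _ => σ.erase v) (fun σ _ => insert v σ) ?_ ?_ ?_ ?_
    · intro σ hσ
      rw [Finset.mem_filter] at hσ ⊢
      exact ⟨h1 σ hσ.1 hσ.2, Finset.notMem_erase v σ⟩
    · intro σ hσ
      rw [Finset.mem_filter] at hσ ⊢
      exact ⟨h2 σ hσ.1 hσ.2, Finset.mem_insert_self v σ⟩
    · intro σ hσ
      exact Finset.insert_erase (Finset.mem_filter.1 hσ).2
    · intro σ hσ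
      exact Finset.erase_insert (Finset.mem_filter.1 hσ).2
  rw [this]
  exact ⟨_, rfl⟩

/-! ### Parity, least cardinality and the homology in each multidegree. -/

variable {K : Type*} [Field K] {M : Ideal (MvPolynomial (Fin n) K)}

theorem mem_taylorSymbols {l : Fin n →₀ ℕ} {σ : Finset (Fin n →₀ ℕ)} :
    σ ∈ taylorSymbols M l ↔ σ ⊆ minimalGenerators M ∧ taylorMdeg σ = l := by
  simp [taylorSymbols]

/-- Toggling `v` pairs all sets except `insert v A`, whose partner `A` does not have multidegree
`l`. -/
theorem IsPuncturedInterval.odd_card {l v : Fin n →₀ ℕ} {A : Finset (Fin n →₀ ℕ)}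
    (h : IsPuncturedInterval (minimalGenerators M) l A v) : Odd (taylorSymbols M l).card := by
  have hvG := h.insert_subset (Finset.mem_insert_self _ _)
  have h0 : insert v A ∈ taylorSymbols M l :=
    mem_taylorSymbols.2 ⟨h.insert_subset, h.mdeg_insert v hvG h.le h.notMem⟩
  rw [← Finset.card_erase_add_one h0]
  refine Even.add_one (even_card_of_toggle (v := v) ?_ ?_)
  · intro σ hσ hv
    rw [Finset.mem_erase, mem_taylorSymbols] at hσ ⊢
    refine ⟨fun heq => Finset.notMem_erase v σ (heq ▸ Finset.mem_insert_self v A),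
      (Finset.erase_subset _ _).trans hσ.2.1, (h.erase σ hσ.2.1 hσ.2.2).resolve_left fun heq => ?_⟩
    exact hσ.1 (heq ▸ (Finset.insert_erase hv).symm)
  · intro σ hσ hv
    rw [Finset.mem_erase, mem_taylorSymbols] at hσ ⊢
    refine ⟨fun heq => h.mdeg_ne ?_, Finset.insert_subset hvG hσ.2.1, ?_⟩
    · rw [← Finset.erase_insert h.notMem, ← heq, Finset.erase_insert hv, hσ.2.2]
    · rw [taylorMdeg_insert, hσ.2.2, sup_eq_right]
      exact h.le

theorem IsPuncturedInterval.minHomDeg_eq {l v : Fin n →₀ ℕ} {A : Finset (Fin n →₀ ℕ)}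
    (h : IsPuncturedInterval (minimalGenerators M) l A v) : minHomDeg M l = A.card + 1 := by
  have hvG := h.insert_subset (Finset.mem_insert_self _ _)
  refine (IsLeast.csInf_eq ⟨⟨insert v A, mem_taylorSymbols.2 ⟨h.insert_subset,
    h.mdeg_insert v hvG h.le h.notMem⟩, Finset.card_insert_of_notMem h.notMem⟩, ?_⟩)
  rintro _ ⟨σ, hσ, rfl⟩
  rw [mem_taylorSymbols] at hσ
  refine Finset.card_lt_card ((h.subset σ hσ.1 hσ.2).ssubset_of_ne ?_)
  rintro rfl
  exact h.mdeg_ne hσ.2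

open scoped Classical in
theorem relHomologyDim_of_isAlmostGeneric {r : (Fin n →₀ ℕ) → ℕ} (hr : Function.Injective r)
    (hM : IsAlmostGeneric M) (k : ℕ) (l : Fin n →₀ ℕ) :
    (taylorResolution K hr (minimalGenerators M)).RelHomologyDim k l
      (if l ∈ oddMultidegrees M ∧ k = minHomDeg M l then 1 else 0) := by
  obtain ⟨i, hi⟩ := hM
  rcases multidegree_cases_of_almostGeneric hi l with h | ⟨v, hv, hvl, h⟩ | ⟨σ₀, h1, h2, h3, h4⟩ |
    ⟨A, v, h⟩
  · rw [if_neg]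
    · exact relHomologyDim_zero_of_forall_ne hr fun σ hσ _ => h σ hσ
    · rintro ⟨hl, -⟩
      obtain ⟨σ, hσ⟩ := Finset.card_pos.1 (Odd.pos hl)
      rw [mem_taylorSymbols] at hσ
      exact h σ hσ.1 hσ.2
  · rw [if_neg]
    · exact relHomologyDim_zero_of_erase hr hv hvl fun σ hσ _ _ => h σ hσ
    · rintro ⟨hl, -⟩
      refine Nat.not_even_iff_odd.2 hl (even_card_of_toggle (v := v) ?_ ?_)
      · intro σ hσ _
        rw [mem_taylorSymbols] at hσ ⊢
        exact ⟨(Finset.erase_subset _ _).trans hσ.1, h σ hσ.1 hσ.2⟩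
      · intro σ hσ _
        rw [mem_taylorSymbols] at hσ ⊢
        refine ⟨Finset.insert_subset hv hσ.1, ?_⟩
        rw [taylorMdeg_insert, hσ.2, sup_eq_right]
        exact hvl
  · have hY : taylorSymbols M l = {σ₀} := by
      ext σ
      rw [mem_taylorSymbols, Finset.mem_singleton]
      exact ⟨fun hσ => h4 σ hσ.1 hσ.2, fun hσ => hσ ▸ ⟨h1, h2⟩⟩
    have hl : l ∈ oddMultidegrees M := by simp [oddMultidegrees, hY]
    have hf : minHomDeg M l = σ₀.card := by simp [minHomDeg, hY]
    by_cases hk : k = σ₀.card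
    · rw [if_pos ⟨hl, hk.trans hf.symm⟩, hk]
      exact relHomologyDim_one_of_unique hr h1 h2 h3 h4
    · rw [if_neg fun h => hk (h.2.trans hf)]
      refine relHomologyDim_zero_of_forall_ne hr fun σ hσ hc hσl => hk ?_
      rw [← hc, h4 σ hσ hσl]
  · by_cases hk : k = A.card + 1
    · rw [if_pos ⟨h.odd_card, hk.trans h.minHomDeg_eq.symm⟩, hk]
      exact h.relHomologyDim_one hr
    · rw [if_neg fun h' => hk (h'.2.trans h.minHomDeg_eq)]
      exact h.relHomologyDim_zero hr hk

end AlmostGeneric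

/-! ### Multigraded resolutions in coordinates -/

section Components

variable {K : Type*} [Field K] {n : ℕ} {ι κ : Type*}

/-- The coordinates of the component of degree `a` of an element of a free multigraded module. -/
noncomputable def component (K : Type*) [Field K] {n : ℕ} {ι : Type*} (deg : ι → (Fin n →₀ ℕ))
    (a : Fin n →₀ ℕ) : (ι → MvPolynomial (Fin n) K) →ₗ[K] (ι → K) where
  toFun w τ := coeff a (w τ * monomial (deg τ) 1)
  map_add' w w' := by
    ext τ
    simp [add_mul]
  map_smul' c w := by
    ext τ
    simp

/-- The homogeneous element of degree `a` with the given coordinates. -/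
noncomputable def homogenize (deg : ι → (Fin n →₀ ℕ)) (a : Fin n →₀ ℕ) (v : ι → K) :
    ι → MvPolynomial (Fin n) K := fun σ => monomial (a - deg σ) (v σ)

variable {deg : ι → (Fin n →₀ ℕ)} {deg' : κ → (Fin n →₀ ℕ)}

theorem component_apply (a : Fin n →₀ ℕ) (w : ι → MvPolynomial (Fin n) K) (τ : ι) :
    component K deg a w τ = coeff a (w τ * monomial (deg τ) 1) := rfl

theorem component_homogenize_self {a : Fin n →₀ ℕ} {v : ι → K}
    (hv : v ∈ supportedIn K deg (Set.Iic a)) : component K deg a (homogenize deg a v) = v := by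
  ext σ
  rw [component_apply, homogenize, monomial_mul, mul_one]
  by_cases h : v σ = 0
  · simp [h]
  · rw [tsub_add_cancel_of_le (hv σ h), coeff_monomial, if_pos rfl]

theorem component_homogenize_of_ne {a b : Fin n →₀ ℕ} {v : ι → K}
    (hv : v ∈ supportedIn K deg (Set.Iic a)) (hab : a ≠ b) :
    component K deg b (homogenize deg a v) = 0 := by
  ext σ
  rw [component_apply, homogenize, monomial_mul, mul_one]
  by_cases h : v σ = 0
  · simp [h]
  · rw [tsub_add_cancel_of_le (hv σ h), coeff_monomial, if_neg hab, Pi.zero_apply]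

theorem component_mem (a : Fin n →₀ ℕ) (w : ι → MvPolynomial (Fin n) K) :
    component K deg a w ∈ supportedIn K deg (Set.Iic a) := by
  intro τ h
  rw [component_apply, coeff_mul_monomial'] at h
  by_contra h'
  exact h (if_neg h')

theorem eq_of_component_eq {w w' : ι → MvPolynomial (Fin n) K}
    (h : ∀ a, component K deg a w = component K deg a w') : w = w' := by
  ext τ a
  have := congrFun (h (a + deg τ)) τ
  rwa [component_apply, component_apply, coeff_mul_monomial, coeff_mul_monomial, mul_one,
    mul_one] at this

theorem exists_component_eq_zero [Fintype ι] (w : ι → MvPolynomial (Fin n) K) :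
    ∃ s : Finset (Fin n →₀ ℕ), ∀ a ∉ s, component K deg a w = 0 := by
  classical
  refine ⟨Finset.univ.biUnion fun τ => (w τ * monomial (deg τ) 1).support, fun a ha => ?_⟩
  ext τ
  by_contra h
  exact ha (Finset.mem_biUnion.2 ⟨τ, Finset.mem_univ _, mem_support_iff.2 h⟩)

theorem exists_component_eq {s : Finset (Fin n →₀ ℕ)} {v : (Fin n →₀ ℕ) → ι → K}
    (hv : ∀ a, v a ∈ supportedIn K deg (Set.Iic a)) (hs : ∀ a ∉ s, v a = 0) :
    ∃ w, ∀ a, component K deg a w = v a := by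
  refine ⟨∑ a ∈ s, homogenize deg a (v a), fun a => ?_⟩
  rw [map_sum]
  by_cases ha : a ∈ s
  · rw [Finset.sum_eq_single a (fun b _ hb => component_homogenize_of_ne (hv b) hb)
      fun h => absurd ha h, component_homogenize_self (hv a)]
  · rw [hs a ha]
    exact Finset.sum_eq_zero fun b hb =>
      component_homogenize_of_ne (hv b) fun h => ha (h ▸ hb)

variable [Fintype κ]

/-- By homogeneity one scalar matrix represents the map in every degree; only the coordinates
allowed to be nonzero depend on `a`. -/
theorem component_mulVec {d : Matrix ι κ (MvPolynomial (Fin n) K)} {c : Matrix ι κ K}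
    (hc : ∀ σ τ, d σ τ * monomial (deg σ) 1 = monomial (deg' τ) (c σ τ)) (a : Fin n →₀ ℕ)
    (w : κ → MvPolynomial (Fin n) K) :
    component K deg a (d.mulVec w) = c.mulVec (component K deg' a w) := by
  ext σ
  simp only [component_apply, Matrix.mulVec, dotProduct, Finset.sum_mul, coeff_sum]
  refine Finset.sum_congr rfl fun τ _ => ?_
  have : d σ τ * w τ * monomial (deg σ) 1 = C (c σ τ) * (w τ * monomial (deg' τ) 1) := by
    rw [mul_right_comm, hc, mul_left_comm, C_mul_monomial, mul_one, mul_comm]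
  rw [this, coeff_C_mul]

theorem le_of_homogeneous {p : MvPolynomial (Fin n) K} {a b : Fin n →₀ ℕ} {c : K}
    (h : p * monomial a 1 = monomial b c) (hc : c ≠ 0) : a ≤ b := by
  have := congrArg (coeff b) h
  rw [coeff_mul_monomial', coeff_monomial, if_pos rfl] at this
  by_contra h'
  rw [if_neg h'] at this
  exact hc this.symm

/-- `P` stands for lying in the kernel of the next map, or of the augmentation, and `Q` for its
homogeneous components. Homogeneous vectors test one direction; for the other, preimages of the
components are added up. -/
theorem exact_iff_strand_exact [Fintype ι] {d : Matrix ι κ (MvPolynomial (Fin n) K)}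
    {c : Matrix ι κ K} (hc : ∀ σ τ, d σ τ * monomial (deg σ) 1 = monomial (deg' τ) (c σ τ))
    {P : (ι → MvPolynomial (Fin n) K) → Prop} {Q : (Fin n →₀ ℕ) → (ι → K) → Prop}
    (hPQ : ∀ w, P w ↔ ∀ a, Q a (component K deg a w)) (hQ : ∀ a, Q a 0) :
    (∀ w, P w ↔ ∃ y, d.mulVec y = w) ↔
      ∀ a, ∀ v ∈ supportedIn K deg (Set.Iic a), Q a v ↔
        ∃ y ∈ supportedIn K deg' (Set.Iic a), c.mulVec y = v := by
  constructor
  · intro h a v hv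
    have hP : P (homogenize deg a v) ↔ Q a v := by
      rw [hPQ]
      constructor
      · intro h'
        have := h' a
        rwa [component_homogenize_self hv] at this
      · intro h' b
        by_cases hab : a = b
        · rw [← hab, component_homogenize_self hv]
          exact h'
        · rw [component_homogenize_of_ne hv hab]
          exact hQ b
    rw [← hP, h]
    constructor
    · rintro ⟨y, hy⟩
      refine ⟨component K deg' a y, component_mem a y, ?_⟩
      rw [← component_mulVec hc, hy, component_homogenize_self hv]
    · rintro ⟨y, hy, rfl⟩
      refine ⟨homogenize deg' a y, eq_of_component_eq (deg := deg) fun b => ?_⟩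
      rw [component_mulVec hc]
      by_cases hab : a = b
      · rw [← hab, component_homogenize_self hv, component_homogenize_self hy]
      · rw [component_homogenize_of_ne hv hab, component_homogenize_of_ne hy hab,
          Matrix.mulVec_zero]
  · intro h w
    rw [hPQ]
    constructor
    · intro hw
      -- Zero is chosen over zero components, so that only finitely many preimages are nonzero and
      -- they assemble into a vector of polynomials.
      have hy : ∀ a, ∃ y ∈ supportedIn K deg' (Set.Iic a), c.mulVec y = component K deg a w ∧
          (component K deg a w = 0 → y = 0) := by
        intro a
        by_cases h0 : component K deg a w = 0
        · exact ⟨0, Submodule.zero_mem _, by rw [h0, Matrix.mulVec_zero], fun _ => rfl⟩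
        · obtain ⟨y, hy, hyw⟩ := (h a _ (component_mem a w)).1 (hw a)
          exact ⟨y, hy, hyw, fun h' => absurd h' h0⟩
      choose y hy hyw hy0 using hy
      obtain ⟨s, hs⟩ := exists_component_eq_zero (deg := deg) w
      obtain ⟨z, hz⟩ := exists_component_eq hy fun a ha => hy0 a (hs a ha)
      refine ⟨z, eq_of_component_eq (deg := deg) fun a => ?_⟩
      rw [component_mulVec hc, hz, hyw]
    · rintro ⟨y, rfl⟩ a
      rw [component_mulVec hc, h a _ (component_mulVec hc a y ▸ component_mem a _)]
      exact ⟨_, component_mem a y, rfl⟩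

end Components

/-! ### Passage between polynomial resolutions and strands. -/

section Ideals

variable {K : Type*} [Field K] {n : ℕ} {M : Ideal (MvPolynomial (Fin n) K)}

/-- The degrees of the monomials in a monomial ideal. -/
abbrev monomialDegrees (M : Ideal (MvPolynomial (Fin n) K)) : Set (Fin n →₀ ℕ) :=
  {a | ∃ g ∈ minimalGenerators M, g ≤ a}

theorem isUpperSet_monomialDegrees (M : Ideal (MvPolynomial (Fin n) K)) :
    IsUpperSet (monomialDegrees M) := fun _ _ hab ⟨g, hg, hga⟩ => ⟨g, hg, hga.trans hab⟩

theorem mem_iff_coeff (hM : IsMonomialIdeal M) {p : MvPolynomial (Fin n) K} :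
    p ∈ M ↔ ∀ a, a ∈ monomialDegrees M ∨ coeff a p = 0 := by
  conv_lhs => rw [← span_minimalGenerators M hM]
  rw [mem_ideal_span_monomial_image]
  refine forall_congr' fun a => ?_
  rw [mem_support_iff, or_comm, ← or_iff_not_imp_left]
  rfl

/-- Membership in a monomial ideal is tested coefficient by coefficient. The case `q = 0` gives
exactness at `F_0`, general `q` gives surjectivity. -/
theorem linearCombination_eq_mk_iff (hM : IsMonomialIdeal M) {ι : Type*} [Fintype ι]
    {deg : ι → (Fin n →₀ ℕ)} {aug : ι → MvPolynomial (Fin n) K ⧸ M} {c : ι → K}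
    (hc : ∀ τ, aug τ = Ideal.Quotient.mk M (monomial (deg τ) (c τ)))
    (w : ι → MvPolynomial (Fin n) K) (q : MvPolynomial (Fin n) K) :
    Fintype.linearCombination (MvPolynomial (Fin n) K) aug w = Ideal.Quotient.mk M q ↔
      ∀ a, a ∈ monomialDegrees M ∨
        Fintype.linearCombination K c (component K deg a w) = coeff a q := by
  have h1 : Fintype.linearCombination (MvPolynomial (Fin n) K) aug w =
      Ideal.Quotient.mk M (∑ τ, w τ * monomial (deg τ) (c τ)) := by
    rw [Fintype.linearCombination_apply, map_sum]
    refine Finset.sum_congr rfl fun τ _ => ?_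
    rw [hc, map_mul]
    rfl
  rw [h1, Ideal.Quotient.mk_eq_mk_iff_sub_mem, mem_iff_coeff hM]
  refine forall_congr' fun a => or_congr_right ?_
  rw [coeff_sub, sub_eq_zero, coeff_sum, Fintype.linearCombination_apply]
  have : ∀ τ, coeff a (w τ * monomial (deg τ) (c τ)) = component K deg a w τ • c τ := by
    intro τ
    rw [component_apply, smul_eq_mul, mul_comm (coeff _ _), ← coeff_C_mul, mul_left_comm,
      C_mul_monomial, mul_one]
  simp only [this]

namespace MultigradedFreeResolution

theorem exists_strandResolution (hM : IsMonomialIdeal M) (F : MultigradedFreeResolution M)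
    (hF : F.IsMinimal) :
    ∃ G : StrandResolution K (monomialDegrees M), G.IsMinimal ∧
      ∀ k l, Nat.card {σ : G.ι k // G.deg k σ = l} = F.basisCount k l := by
  choose c hc using F.d_homogeneous
  choose e he using F.aug_homogeneous
  have hentry : ∀ i (v : F.ι (i + 1) → K) σ, (Matrix.of (c i)).mulVec v σ ≠ 0 →
      ∃ τ, c i σ τ ≠ 0 ∧ v τ ≠ 0 := by
    intro i v σ h
    obtain ⟨τ, _, h0⟩ := Finset.exists_ne_zero_of_sum_ne_zero h
    exact ⟨τ, left_ne_zero_of_mul h0, right_ne_zero_of_mul h0⟩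
  let G : StrandResolution K (monomialDegrees M) :=
    { ι := F.ι
      fintype_ι := F.fintype_ι
      deg := F.mdeg
      d := fun i => (Matrix.of (c i)).mulVecLin
      ε := Fintype.linearCombination K e
      graded := by
        intro i a v hv σ hσ
        obtain ⟨τ, h1, h2⟩ := hentry i v σ hσ
        exact (le_of_homogeneous (hc i σ τ) h1).trans (hv τ h2)
      surjective := by
        intro a ha
        obtain ⟨w, hw⟩ := F.aug_surjective (Ideal.Quotient.mk M (monomial a 1))
        refine ⟨component K (F.mdeg 0) a w, component_mem a w, ?_⟩
        rw [((linearCombination_eq_mk_iff hM he w _).1 hw a).resolve_left ha, coeff_monomial,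
          if_pos rfl]
      exact_zero := by
        refine (exact_iff_strand_exact (hc 0) (fun w => ?_) fun a => Or.inr (map_zero _)).1
          F.exact_zero
        have := linearCombination_eq_mk_iff hM he w 0
        rwa [map_zero] at this
      exact_succ := fun i => by
        refine (exact_iff_strand_exact (hc (i + 1))
          (Q := fun _ v => (Matrix.of (c i)).mulVecLin v = 0) (fun w => ?_)
          fun a => map_zero _).1 (F.exact_succ i)
        constructor
        · intro h a
          exact (component_mulVec (hc i) a w).symm.trans
            ((congrArg (component K (F.mdeg i) a) h).trans (map_zero _))
        · intro h
          refine eq_of_component_eq (deg := F.mdeg i) fun a => ?_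
          exact (component_mulVec (hc i) a w).trans ((h a).trans (map_zero _).symm) }
  refine ⟨G, fun i l v hv σ hσ => ?_, fun k l => rfl⟩
  obtain ⟨τ, h1, h2⟩ := hentry i v σ hσ
  have hle := le_of_homogeneous (hc i σ τ) h1
  have hτ : F.mdeg (i + 1) τ ≤ l := hv τ h2
  -- A nonzero scalar between basis elements of equal degree would be a constant entry of the
  -- polynomial matrix, hence a unit.
  refine Set.mem_Iio.2 (lt_of_le_of_ne (hle.trans hτ) fun heq => hF i σ τ ?_)
  have heq' : F.mdeg (i + 1) τ = F.mdeg i σ := le_antisymm (hτ.trans heq.ge) hle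
  have h3 := hc i σ τ
  rw [heq', ← mul_one (c i σ τ), ← C_mul_monomial] at h3
  rw [mul_right_cancel₀ (by simp) h3]
  exact (isUnit_iff_ne_zero.2 h1).map C

theorem exists_isMinimal (hM : IsMonomialIdeal M) :
    ∃ F : MultigradedFreeResolution M, F.IsMinimal := by
  classical
  obtain ⟨G, hG⟩ := StrandResolution.exists_isMinimal (K := K) (isUpperSet_monomialDegrees M)
    -- The ideal gains something new only in the degrees of its minimal generators.
    (minimalGenerators M) (by
      rintro a ⟨g, hg, hga⟩ ha
      exact ⟨g, lt_of_le_of_ne hga fun h => ha (h ▸ hg), g, hg, le_rfl⟩)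
  let c : ∀ i, Matrix (G.ι i) (G.ι (i + 1)) K := fun i => LinearMap.toMatrix' (G.d i)
  have hcd : ∀ i v, (c i).mulVec v = G.d i v := fun i v => LinearMap.toMatrix'_mulVec _ _
  -- Minimality makes degrees drop strictly along nonzero entries, so the monomial entries built
  -- below have zero constant term and are not units.
  have hlt : ∀ i σ τ, c i σ τ ≠ 0 → G.deg i σ < G.deg (i + 1) τ := by
    intro i σ τ h
    refine hG i (G.deg (i + 1) τ) (Pi.single τ 1)
      (single_mem_supportedIn (Set.mem_Iic.2 le_rfl) 1) σ ?_
    rwa [← hcd, Matrix.mulVec_single_one]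
  let d : ∀ i, Matrix (G.ι i) (G.ι (i + 1)) (MvPolynomial (Fin n) K) := fun i =>
    Matrix.of fun σ τ => monomial (G.deg (i + 1) τ - G.deg i σ) (c i σ τ)
  have hd : ∀ i σ τ, d i σ τ * monomial (G.deg i σ) 1 = monomial (G.deg (i + 1) τ) (c i σ τ) := by
    intro i σ τ
    change monomial (G.deg (i + 1) τ - G.deg i σ) (c i σ τ) * _ = _
    rw [monomial_mul, mul_one]
    by_cases h : c i σ τ = 0
    · simp [h]
    · rw [tsub_add_cancel_of_le (hlt i σ τ h).le]
  let e : G.ι 0 → K := fun τ => G.ε (Pi.single τ 1)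
  have he : ∀ v, Fintype.linearCombination K e v = G.ε v := by
    have : Fintype.linearCombination K e = G.ε := by
      refine LinearMap.pi_ext' fun τ => LinearMap.ext_ring ?_
      simp [e, Fintype.linearCombination_apply_single]
    exact LinearMap.congr_fun this
  let aug : G.ι 0 → MvPolynomial (Fin n) K ⧸ M := fun τ =>
    Ideal.Quotient.mk M (monomial (G.deg 0 τ) (e τ))
  have haug := linearCombination_eq_mk_iff hM (aug := aug) (fun τ => rfl)
  let F : MultigradedFreeResolution M :=
    { ι := G.ι
      fintype_ι := G.fintype_ι
      mdeg := G.deg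
      d := d
      aug := aug
      d_homogeneous := fun i σ τ => ⟨_, hd i σ τ⟩
      aug_homogeneous := fun τ => ⟨_, rfl⟩
      aug_surjective := by
        intro q
        obtain ⟨q, rfl⟩ := Ideal.Quotient.mk_surjective q
        have hv : ∀ a, ∃ v ∈ G.le 0 a, (a ∈ monomialDegrees M ∨ G.ε v = coeff a q) ∧
            (a ∉ q.support → v = 0) := by
          intro a
          by_cases ha : a ∈ monomialDegrees M
          · exact ⟨0, Submodule.zero_mem _, Or.inl ha, fun _ => rfl⟩
          · obtain ⟨v, hv, h1⟩ := G.surjective a ha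
            refine ⟨coeff a q • v, Submodule.smul_mem _ _ hv, Or.inr (by simp [h1]), fun h => ?_⟩
            rw [notMem_support_iff.1 h, zero_smul]
        choose v hv hvq hv0 using hv
        obtain ⟨w, hw⟩ := exists_component_eq hv hv0
        refine ⟨w, (haug w q).2 fun a => ?_⟩
        rw [hw, he]
        exact hvq a
      exact_zero := by
        refine (exact_iff_strand_exact (hd 0) (Q := fun a v => a ∈ monomialDegrees M ∨ G.ε v = 0)
          (fun w => ?_) fun a => Or.inr (map_zero _)).2 ?_
        · have := haug w 0
          rw [map_zero] at this
          simpa only [he, coeff_zero] using this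
        · intro a v hv
          simpa only [hcd] using G.exact_zero a v hv
      exact_succ := fun i => by
        refine (exact_iff_strand_exact (hd (i + 1)) (Q := fun a v => G.d i v = 0)
          (fun w => ?_) fun a => map_zero _).2 ?_
        · constructor
          · intro h a
            rw [← hcd, ← component_mulVec (hd i)]
            exact (congrArg (component K (G.deg i) a) h).trans (map_zero _)
          · intro h
            refine eq_of_component_eq (deg := G.deg i) fun a => ?_
            rw [map_zero, Matrix.mulVecLin_apply, component_mulVec (hd i), hcd, h]
        · intro a v hv
          simpa only [hcd] using G.exact_succ i a v hv }
  refine ⟨F, fun i σ τ h => ?_⟩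
  have h1 := (h.map (constantCoeff (σ := Fin n) (R := K))).ne_zero
  change constantCoeff (monomial (G.deg (i + 1) τ - G.deg i σ) (c i σ τ)) ≠ 0 at h1
  rw [constantCoeff_monomial] at h1
  by_cases h0 : c i σ τ = 0
  · simp [h0] at h1
  · refine h1 (if_neg fun h2 => ?_)
    exact (hlt i σ τ h0).not_ge (tsub_eq_zero_iff_le.1 h2)

end MultigradedFreeResolution

end Ideals

theorem mainTheorem6 {K : Type*} [Field K] {n : ℕ} (M : Ideal (MvPolynomial (Fin n) K))
    (hM : IsMonomialIdeal M) (hgen : IsAlmostGeneric M) :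
    HasCharacteristicBettiInMinimalHomDegrees M := by
  intro k l
  refine ⟨MultigradedFreeResolution.exists_isMinimal hM, fun F hF => ?_⟩
  -- The injection `r` serves only to order the monomials and so to fix the signs of the Taylor
  -- differential.
  obtain ⟨r, hr⟩ := Countable.exists_injective_nat (Fin n →₀ ℕ)
  obtain ⟨G, hG, hcard⟩ := F.exists_strandResolution hM hF
  rw [← hcard]
  exact hG.card_eq (isUpperSet_monomialDegrees M) (relHomologyDim_of_isAlmostGeneric hr hgen k l)
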